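/- **Hypergraph Vertex-at-a-time Matching (HVM).** Let $d\ge 1$. An instance is a finite hypergraph with vertex set $L\sqcup R$ and non-negative edge weights $w$, in which every hyperedge contains exactly one vertex of $L$ and at most $d$ vertices of $R$. The algorithm knows $|L|$, $R$ and $d$. The vertices of $L$ arrive in uniformly random order; when $l$ arrives, the hyperedges containing $l$ and their weights are revealed, and the algorithm must irrevocably accept at most one of them, the accepted hyperedges being pairwise disjoint. $\mathrm{OPT}$ is the maximum total weight of a set of pairwise disjoint hyperedges. Ties between weights are resolved throughout by one fixed linear order of the hyperedges, independent of the arrival order. $\textsc{Greedy}$ goes through hyperedges in decreasing order of weight and selects each one that is disjoint from those selected before. Let $p=1-\frac1{2d}$. *SampleAndPrice.* Draw $k\sim\mathrm{Binom}(|L|,p)$ independently of the arrival order and let $L'$ be the set of the first $k$ arriving vertices, none of whose hyperedges is accepted. Let $M_1$ be the output of $\textsc{Greedy}$ on the hyperedges whose vertex in $L$ lies in $L'$, and let $\mathrm{price}(v)$ be the weight of the hyperedge of $M_1$ containing $v$ ($0$ if there is none). For each later vertex $l$, in order of arrival, let $e$ be the highest-weight hyperedge containing $l$ with $w(e)\ge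 \mathrm{price}(v)$ for all $v\in e$ (if $w(e)=\mathrm{price}(v)$ and $f\in M_1$ contains $v$, it is also required that $e$ comes before $f$ in the tie-breaking order); accept $e$ if it exists and is disjoint from the hyperedges accepted before. *Simulate.* Start with $M_1=M_2=\emptyset$ and all vertices of $L$ unassigned. Go through all hyperedges $e$ in decreasing order of weight; if the vertex of $L$ in $e$ is unassigned and $e$ is disjoint from all members of $M_1$, mark that vertex as assigned and toss an independent coin with probability $p$ of heads, adding $e$ to $M_1$ on heads and to $M_2$ on tails. Finally let $M_3$ be the set of those $e\in M_2$ that are disjoint from all other members of $M_2$. **Theorem.** 1. For each fixed $k$, SampleAndPrice is an online algorithm in the above sense. For every HVM instance, the set $M_3$ of Simulate and the output $M$ of SampleAndPrice satisfy $$\mathbb E[w(M_3)]\ \ge\ \frac{\mathrm{OPT}}{12d(d+1)},\qquad \mathbb E[w(M)]\ \ge\ \frac{\mathrm{OPT}}{12d(d+1)},$$ and hence $\mathrm{OPT}\le 24d^2\,\mathbb E[w(M)]$: SampleAndPrice is $O(d^2)$-competitive. 2. (Hypergraph edge-at-a-time matching.) Let a finite family of hyperedges with non-negative weights, each with at most $d$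 vertices, arrive one at a time in uniformly random order, each to be irrevocably accepted or rejected on arrival, the accepted ones being pairwise disjoint. SampleAndPrice, applied to the HVM instance in which $R$ is the vertex set and each hyperedge is extended by a vertex of $L$ of its own, is an online algorithm for this problem, and its output $M$ satisfies $\mathbb E[w(M)]\ge \mathrm{OPT}/(12d(d+1))$ and $\mathrm{OPT}\le 24d^2\,\mathbb E[w(M)]$, where $\mathrm{OPT}$ is the maximum weight of a set of pairwise disjoint hyperedges. 3. (General graphs.) In particular, for a graph with finitely many edges with non-negative weights, whose edges arrive one at a time in uniformly random order, every matching has weight at most $72\,\mathbb E[w(M)]$, where $M$ is the output of the algorithm of part 2 with $d=2$. -/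

import Mathlib

open scoped Finset

noncomputable section

open scoped Classical

/-- An instance of Hypergraph Vertex-at-a-time Matching.  Vertices are `L ⊕ R`; the hyperedges are
indexed by `E`, and the hyperedge `e` is `{left e} ∪ right e`, with exactly one vertex in `L`
and at most `d` vertices in `R`. -/
structure HVM (d : ℕ) (L R E : Type*) where
  left : E → L
  right : E → Finset R
  weight : E → ℝ
  card_right_le : ∀ e, #(right e) ≤ d
  weight_nonneg : ∀ e, 0 ≤ weight e

namespace HVM

variable {d : ℕ} {L R E : Type*}

/-- Total weight of a set of hyperedges. -/
def totalWeight (G : HVM d L R E) (M : Finset E) : ℝ := ∑ e ∈ M, G.weight e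

/-- Two hyperedges have no vertex in common. -/
def DisjointEdges (G : HVM d L R E) (e f : E) : Prop :=
  G.left e ≠ G.left f ∧ Disjoint (G.right e) (G.right f)

/-- The hyperedge `e` shares no vertex with any member of `M`. -/
def DisjointFrom (G : HVM d L R E) (e : E) (M : Finset E) : Prop :=
  ∀ f ∈ M, G.DisjointEdges e f

/-- A set of pairwise disjoint hyperedges. -/
def IsMatching (G : HVM d L R E) (M : Finset E) : Prop :=
  ∀ e ∈ M, ∀ f ∈ M, e ≠ f → G.DisjointEdges e f

theorem isMatching_empty (G : HVM d L R E) : G.IsMatching ∅ := by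
  intro e he
  simp at he

/-- The maximum weight of a set of pairwise disjoint hyperedges. -/
def opt [Fintype E] (G : HVM d L R E) : ℝ :=
  (Finset.univ.filter G.IsMatching).sup' ⟨∅, by simp [isMatching_empty]⟩ G.totalWeight

/-! ### Decreasing order of weight

The linear order on `E` is a fixed tie-breaking rule. -/

/-- `e` comes no later than `f` in decreasing order of weight, ties being broken by the fixed
order of `E`. -/
def Precedes [LinearOrder E] (G : HVM d L R E) (e f : E) : Prop :=
  G.weight f < G.weight e ∨ (G.weight e = G.weight f ∧ e ≤ f)

instance [LinearOrder E] (G : HVM d L R E) : IsTrans E G.Precedes where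
  trans a b c := by
    rintro (h | ⟨h, h'⟩) (k | ⟨k, k'⟩)
    · exact Or.inl (k.trans h)
    · exact Or.inl (k ▸ h)
    · exact Or.inl (h ▸ k)
    · exact Or.inr ⟨h.trans k, h'.trans k'⟩

instance [LinearOrder E] (G : HVM d L R E) : Std.Antisymm G.Precedes where
  antisymm a b := by
    rintro (h | ⟨h, h'⟩) (k | ⟨k, k'⟩)
    · exact absurd h k.asymm
    · exact absurd k h.ne
    · exact absurd h k.ne
    · exact le_antisymm h' k'

instance [LinearOrder E] (G : HVM d L R E) : Std.Total G.Precedes where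
  total a b := by
    rcases lt_trichotomy (G.weight a) (G.weight b) with h | h | h
    · exact Or.inr (Or.inl h)
    · rcases le_total a b with h' | h'
      · exact Or.inl (Or.inr ⟨h, h'⟩)
      · exact Or.inr (Or.inr ⟨h.symm, h'⟩)
    · exact Or.inl (Or.inl h)

/-- The list of the members of `S` in decreasing order of weight. -/
def sortEdges [LinearOrder E] (G : HVM d L R E) (S : Finset E) : List E :=
  S.sort G.Precedes

/-! ### Greedy and SampleAndPrice -/

/-- The offline greedy algorithm on the hyperedges whose vertex in `L` belongs to `S`. -/
def greedy [Fintype E] [LinearOrder E] (G : HVM d L R E) (S : Finset L) : Finset E :=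
  (G.sortEdges {e | G.left e ∈ S}).foldl
    (fun M e => if G.DisjointFrom e M then insert e M else M) ∅

/-- The price of `v`: the weight of the (at most one) hyperedge of the matching `M₁` that
contains `v`, and `0` if there is none. -/
def price (G : HVM d L R E) (M₁ : Finset E) (v : R) : ℝ :=
  ∑ f ∈ M₁ with v ∈ G.right f, G.weight f

/-- The weight of `e` is at least the price of `v`, where equality of the two weights is resolved
by the same tie-breaking rule as in the sorting of hyperedges.  When distinct hyperedges have
distinct weights this is just `price v ≤ weight e`. -/
def MeetsPrice [LinearOrder E] (G : HVM d L R E) (M₁ : Finset E) (e : E) (v : R) : Prop :=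
  G.price M₁ v < G.weight e ∨
    (G.price M₁ v = G.weight e ∧ ∀ f ∈ M₁, v ∈ G.right f → e ≤ f)

/-- The highest-weight hyperedge containing `l` that meets the price of each of its vertices, if
there is one.  (Only vertices in `R` matter: for `l` not in the sample no hyperedge of `M₁` contains
`l`, so that the price of `l` is `0`.) -/
def candidate [Fintype E] [LinearOrder E] (G : HVM d L R E) (M₁ : Finset E) (l : L) :
    Option E :=
  (G.sortEdges {e | G.left e = l ∧ ∀ v ∈ G.right e, G.MeetsPrice M₁ e v}).head?

/-- The treatment of an arriving vertex `l` after the sampling phase: its candidate hyperedge is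
accepted if it is disjoint from the hyperedges accepted so far. -/
def step [Fintype E] [LinearOrder E] (G : HVM d L R E) (M₁ : Finset E) (M : Finset E) (l : L) :
    Finset E :=
  match G.candidate M₁ l with
  | none => M
  | some e => if G.DisjointFrom e M then insert e M else M

/-- SampleAndPrice with sample size `k`: the set of hyperedges accepted after the vertices in the
list `arrivals` have arrived, in this order. -/
def sampleAndPrice [Fintype E] [LinearOrder E] (k : ℕ) (G : HVM d L R E) (arrivals : List L) :
    Finset E :=
  (arrivals.drop k).foldl (G.step (G.greedy (arrivals.take k).toFinset)) ∅

/-! ### The online model -/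

/-- `G` and `G'` show the same hyperedges, with the same weights, at every vertex in
`arrivals`. -/
def SameRevealed (G G' : HVM d L R E) (arrivals : List L) : Prop :=
  ∀ l ∈ arrivals, ∀ e, (G.left e = l ↔ G'.left e = l) ∧
    (G.left e = l → G.right e = G'.right e ∧ G.weight e = G'.weight e)

/-- `alg G arrivals` (the set of hyperedges held after the given arrivals) is produced by an online
algorithm: it starts empty; when a vertex `l` arrives, at most one hyperedge is accepted, which
contains `l` and is disjoint from those accepted before, and nothing is ever discarded; and what is
held depends only on what has been revealed so far. -/
def IsOnline (alg : HVM d L R E → List L → Finset E) : Prop :=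
  (∀ G, alg G [] = ∅) ∧
  (∀ G arrivals l, (arrivals ++ [l]).Nodup →
    alg G (arrivals ++ [l]) = alg G arrivals ∨
      ∃ e, G.left e = l ∧ G.DisjointFrom e (alg G arrivals) ∧
        alg G (arrivals ++ [l]) = insert e (alg G arrivals)) ∧
  (∀ G G' arrivals, SameRevealed G G' arrivals → alg G arrivals = alg G' arrivals)

/-- The sampling probability `1 - 1 / (2 d)`. -/
def sampleProb (d : ℕ) : ℝ := 1 - 1 / (2 * d)

/-- The expected weight of the output of SampleAndPrice, when the sample size `k` is drawn from the
binomial distribution with parameters `|L|` and `1 - 1 / (2 d)` and, independently, the arrival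
order of `L` is uniformly random. -/
def expectedSampleAndPrice [Fintype L] [Fintype E] [LinearOrder E] (G : HVM d L R E) : ℝ :=
  ∑ k ∈ Finset.range (Fintype.card L + 1),
    ((Fintype.card L).choose k * sampleProb d ^ k *
        (1 - sampleProb d) ^ (Fintype.card L - k)) *
      ((∑ σ : Fin (Fintype.card L) ≃ L, G.totalWeight (sampleAndPrice k G (List.ofFn σ))) /
        (Fintype.card L).factorial)

/-! ### Simulate -/

/-- The state of Simulate: the assigned vertices of `L` and the hyperedge sets `M₁`, `M₂`. -/
structure SimState (L E : Type*) where
  assigned : Finset L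
  M₁ : Finset E
  M₂ : Finset E

/-- The treatment of one hyperedge by Simulate.  Since at most one hyperedge is considered for each
vertex of `L`, the coins are indexed by `L`; `heads` is the set of vertices whose coin shows
heads. -/
def simStep (G : HVM d L R E) (heads : Finset L) (s : SimState L E) (e : E) : SimState L E :=
  if G.left e ∉ s.assigned ∧ G.DisjointFrom e s.M₁ then
    if G.left e ∈ heads then ⟨insert (G.left e) s.assigned, insert e s.M₁, s.M₂⟩
    else ⟨insert (G.left e) s.assigned, s.M₁, insert e s.M₂⟩
  else s

/-- The final state of Simulate: all hyperedges are treated in decreasing order of weight. -/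
def simulate [Fintype E] [LinearOrder E] (G : HVM d L R E) (heads : Finset L) : SimState L E :=
  (G.sortEdges Finset.univ).foldl (G.simStep heads) ⟨∅, ∅, ∅⟩

/-- The members of `M₂` that are disjoint from the rest of `M₂`. -/
def simulateM₃ [Fintype E] [LinearOrder E] (G : HVM d L R E) (heads : Finset L) : Finset E :=
  {e ∈ (G.simulate heads).M₂ | G.DisjointFrom e ((G.simulate heads).M₂.erase e)}

/-- The expected weight of `M₃`, the coins being independent and showing heads with probability
`1 - 1 / (2 d)`. -/
def expectedM₃ [Fintype L] [Fintype E] [LinearOrder E] (G : HVM d L R E) : ℝ :=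
  ∑ heads : Finset L,
    (sampleProb d ^ #heads * (1 - sampleProb d) ^ (Fintype.card L - #heads)) *
      G.totalWeight (G.simulateM₃ heads)

end HVM

/-- An instance of Hypergraph Edge-at-a-time Matching: a hypergraph on `V` whose hyperedges,
indexed by `E`, have at most `d` vertices. -/
structure HEM (d : ℕ) (V E : Type*) where
  verts : E → Finset V
  weight : E → ℝ
  card_verts_le : ∀ e, #(verts e) ≤ d
  weight_nonneg : ∀ e, 0 ≤ weight e

namespace HEM

variable {d : ℕ} {V E : Type*}

/-- Total weight of a set of hyperedges. -/
def totalWeight (H : HEM d V E) (M : Finset E) : ℝ := ∑ e ∈ M, H.weight e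

/-- A set of pairwise disjoint hyperedges. -/
def IsMatching (H : HEM d V E) (M : Finset E) : Prop :=
  ∀ e ∈ M, ∀ f ∈ M, e ≠ f → Disjoint (H.verts e) (H.verts f)

theorem isMatching_empty (H : HEM d V E) : H.IsMatching ∅ := by
  intro e he
  simp at he

/-- The maximum weight of a set of pairwise disjoint hyperedges. -/
def opt [Fintype E] (H : HEM d V E) : ℝ :=
  (Finset.univ.filter H.IsMatching).sup' ⟨∅, by simp [isMatching_empty]⟩ H.totalWeight

/-- The reduction to the vertex-at-a-time problem: `R` is the vertex set `V`, and each hyperedge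
gets a vertex of `L` of its own. -/
def toHVM (H : HEM d V E) : HVM d E V E where
  left := id
  right := H.verts
  weight := H.weight
  card_right_le := H.card_verts_le
  weight_nonneg := H.weight_nonneg

/-- `alg H arrivals` (the set of hyperedges held after the given hyperedges have arrived) is
produced by an online algorithm: it starts empty; an arriving hyperedge is either rejected or,
being disjoint from those accepted before, accepted, and nothing is ever discarded; and what is
held depends only on the hyperedges revealed so far and their weights. -/
def IsOnline (alg : HEM d V E → List E → Finset E) : Prop :=
  (∀ H, alg H [] = ∅) ∧
  (∀ H arrivals e, (arrivals ++ [e]).Nodup →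
    alg H (arrivals ++ [e]) = alg H arrivals ∨
      ((∀ f ∈ alg H arrivals, Disjoint (H.verts e) (H.verts f)) ∧
        alg H (arrivals ++ [e]) = insert e (alg H arrivals))) ∧
  (∀ H H' arrivals, (∀ e ∈ arrivals, H.verts e = H'.verts e ∧ H.weight e = H'.weight e) →
    alg H arrivals = alg H' arrivals)

/-- SampleAndPrice with sample size `k`, run on the reduced instance. -/
def sampleAndPrice [Fintype E] [LinearOrder E] (k : ℕ) (H : HEM d V E) (arrivals : List E) :
    Finset E :=
  HVM.sampleAndPrice k H.toHVM arrivals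

/-- The expected weight of the output of SampleAndPrice when the sample size is binomial with
parameters `|E|` and `1 - 1 / (2 d)` and, independently, the arrival order of the hyperedges is
uniformly random. -/
def expectedSampleAndPrice [Fintype E] [LinearOrder E] (H : HEM d V E) : ℝ :=
  ∑ k ∈ Finset.range (Fintype.card E + 1),
    ((Fintype.card E).choose k * HVM.sampleProb d ^ k *
        (1 - HVM.sampleProb d) ^ (Fintype.card E - k)) *
      ((∑ σ : Fin (Fintype.card E) ≃ E, H.totalWeight (sampleAndPrice k H (List.ofFn σ))) /
        (Fintype.card E).factorial)

/-- The edge-at-a-time matching problem in the graph `Γ` with edge weights `w`. -/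
def ofGraph {V : Type*} (Γ : SimpleGraph V) (w : Γ.edgeSet → ℝ) (hw : ∀ e, 0 ≤ w e) :
    HEM 2 V Γ.edgeSet where
  verts e := (e : Sym2 V).toFinset
  weight := w
  card_verts_le e := by
    rw [Sym2.card_toFinset]
    split_ifs <;> simp
  weight_nonneg := hw

end HEM

/-- The total weight of the edges of a subgraph. -/
def subgraphWeight {V : Type*} {Γ : SimpleGraph V} [Fintype Γ.edgeSet] (w : Γ.edgeSet → ℝ)
    (M : Γ.Subgraph) : ℝ :=
  ∑ e ∈ Finset.univ.filter (fun e : Γ.edgeSet => (e : Sym2 V) ∈ M.edgeSet), w e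

end

/-! Fix the set `S` of vertices showing heads and use it as the sample. Simulate and SampleAndPrice
then do nearly the same thing. The `M₁` of Simulate is Greedy on `S` (`simulate_M₁`), and its `M₂`
consists of the candidates of the vertices outside `S` (`mem_simulate_M₂_iff`). Every accepted
hyperedge is a candidate, so a candidate disjoint from all the others is accepted in any arrival
order (`foldl_step_superset`), and `M₃` is contained in the output. A binomial prefix of a random
order contains each vertex independently with probability `p` (`coinExp_eq_sum_arrivals`), so the
expectations compare as well, and only `M₃` has to be bounded.

For `M₃` three estimates are chained. (a) A heaviest matching restricted to `S` has expected weight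
`p * OPT`, and Greedy is a `(d + 1)`-approximation, so `p * OPT ≤ (d + 1) * E[w(M₁)]`. (b) Each
tossed hyperedge goes to `M₁` or `M₂` with odds `p : 1 - p`, so the expected weights of `M₁` and
`M₂` are in this ratio. (c) `E[w(M₂)] ≤ 4 * E[w(M₃)]` (`totalWeight_M₂_le_isolated`). A hyperedge of
`M₂` stays isolated with probability at least `p ^ d ≥ 1/2` once it has entered without a collision.
Collisions are charged to active vertices, those covered by `M₂` but not by `M₁`: a toss creates at
most `1/2` of them in expectation, and a collision uses up at least one.

Statements (b) and (c) are submartingale arguments, made uniform by `le_coinExp_foldl`. Edge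
arrivals and graphs are special cases. -/

noncomputable section
open scoped Classical
namespace HVM
variable {d : ℕ} {L R E : Type*}
/-! ### Independent coins -/

/-- The expectation of `f`, applied to the random set of those elements of `L` whose independent
coin, of probability `p`, shows heads. -/
def coinExp [Fintype L] (p : ℝ) (f : Finset L → ℝ) : ℝ :=
  ∑ heads : Finset L, (p ^ #heads * (1 - p) ^ (Fintype.card L - #heads)) * f heads

theorem coinExp_mono [Fintype L] {p : ℝ} (hp0 : 0 ≤ p) (hp1 : p ≤ 1) {f g : Finset L → ℝ}
    (h : ∀ S, f S ≤ g S) : coinExp p f ≤ coinExp p g :=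
  Finset.sum_le_sum fun S _ => mul_le_mul_of_nonneg_left (h S)
    (mul_nonneg (pow_nonneg hp0 _) (pow_nonneg (sub_nonneg.2 hp1) _))

theorem coinExp_const [Fintype L] (p c : ℝ) : coinExp (L := L) p (fun _ => c) = c := by
  unfold coinExp
  rw [← Finset.sum_mul, Fintype.sum_pow_mul_eq_add_pow]
  simp

theorem coinExp_add [Fintype L] (p : ℝ) (f g : Finset L → ℝ) :
    coinExp p (fun S => f S + g S) = coinExp p f + coinExp p g := by
  simp only [coinExp, mul_add, Finset.sum_add_distrib]

theorem coinExp_const_mul [Fintype L] (p c : ℝ) (f : Finset L → ℝ) :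
    coinExp p (fun S => c * f S) = c * coinExp p f := by
  simp only [coinExp, Finset.mul_sum]
  exact Finset.sum_congr rfl fun S _ => by ring

theorem coinExp_sum [Fintype L] {ι : Type*} (p : ℝ) (s : Finset ι) (f : ι → Finset L → ℝ) :
    coinExp p (fun S => ∑ i ∈ s, f i S) = ∑ i ∈ s, coinExp p (f i) := by
  simp only [coinExp, Finset.mul_sum]
  exact Finset.sum_comm

/-- Conditioning on the coin of `l`. -/
theorem coinExp_split [Fintype L] (p : ℝ) (f : Finset L → ℝ) (l : L) :
    coinExp p f =
      p * coinExp p (fun S => f (insert l S)) + (1 - p) * coinExp p (fun S => f (S.erase l)) := by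
  have key : ∀ g : Finset L → ℝ, ∑ S, g S =
      ∑ S ∈ (Finset.univ.erase l).powerset, (g S + g (insert l S)) := by
    intro g
    rw [Finset.sum_add_distrib, ← Finset.sum_powerset_insert (Finset.notMem_erase l _),
      Finset.insert_erase (Finset.mem_univ l), Finset.powerset_univ]
  simp only [coinExp]
  rw [key, key, key, Finset.mul_sum, Finset.mul_sum, ← Finset.sum_add_distrib]
  refine Finset.sum_congr rfl fun S hS => ?_
  have hl : l ∉ S := fun h => Finset.notMem_erase l _ (Finset.mem_powerset.1 hS h)
  -- Both exponents of `1 - p` are truncated subtractions; writing them as `m + 1` and `m` leaves a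
  -- polynomial identity.
  have hc : #S + 1 ≤ Fintype.card L := by
    rw [← Finset.card_insert_of_notMem hl]
    exact Finset.card_le_univ _
  obtain ⟨m, hm⟩ := Nat.exists_eq_add_of_le hc
  have h1 : Fintype.card L - #S = m + 1 := by omega
  have h2 : Fintype.card L - (#S + 1) = m := by omega
  rw [Finset.card_insert_of_notMem hl, h1, h2, Finset.insert_idem, Finset.erase_insert hl,
    Finset.erase_eq_of_notMem hl]
  ring

theorem coinExp_mem [Fintype L] (p : ℝ) (l : L) (c : ℝ) :
    coinExp p (fun S => if l ∈ S then c else 0) = p * c := by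
  rw [coinExp_split p _ l]
  simp [coinExp_const]

/-! ### Simulate as a random process -/

/-- Simulate tosses a coin for `e` in state `s`. -/
def Tosses (G : HVM d L R E) (s : SimState L E) (e : E) : Prop :=
  G.left e ∉ s.assigned ∧ G.DisjointFrom e s.M₁

/-- The state after the coin of `e` showed heads. -/
def headState (G : HVM d L R E) (s : SimState L E) (e : E) : SimState L E :=
  ⟨insert (G.left e) s.assigned, insert e s.M₁, s.M₂⟩

/-- The state after the coin of `e` showed tails. -/
def tailState (G : HVM d L R E) (s : SimState L E) (e : E) : SimState L E :=
  ⟨insert (G.left e) s.assigned, s.M₁, insert e s.M₂⟩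

theorem mem_headState_M₁ {G : HVM d L R E} {s : SimState L E} {e f : E} :
    f ∈ (G.headState s e).M₁ ↔ f = e ∨ f ∈ s.M₁ := Finset.mem_insert

theorem mem_tailState_M₂ {G : HVM d L R E} {s : SimState L E} {e f : E} :
    f ∈ (G.tailState s e).M₂ ↔ f = e ∨ f ∈ s.M₂ := Finset.mem_insert

theorem simStep_eq (G : HVM d L R E) (heads : Finset L) (s : SimState L E) (e : E) :
    G.simStep heads s e =
      if G.Tosses s e then if G.left e ∈ heads then G.headState s e else G.tailState s e
      else s := by
  by_cases h : G.Tosses s e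
  · rw [if_pos h]
    exact if_pos h
  · rw [if_neg h]
    exact if_neg h

/-- The coins of assigned vertices do not matter. -/
theorem foldl_simStep_congr (G : HVM d L R E) {S T : Finset L} (ℓ : List E) :
    ∀ s : SimState L E, (∀ l, l ∉ s.assigned → (l ∈ S ↔ l ∈ T)) →
      ℓ.foldl (G.simStep S) s = ℓ.foldl (G.simStep T) s := by
  induction ℓ with
  | nil => intro s _; rfl
  | cons e t ih =>
    intro s h
    have hs : G.simStep S s e = G.simStep T s e := by
      rw [simStep_eq, simStep_eq]
      by_cases hc : G.Tosses s e
      · simp only [h _ hc.1]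
      · simp [hc]
    rw [List.foldl_cons, List.foldl_cons, hs]
    refine ih _ fun l hl => h l fun hl' => hl ?_
    rw [simStep_eq]
    split_ifs
    · exact Finset.mem_insert_of_mem hl'
    · exact Finset.mem_insert_of_mem hl'
    · exact hl'

/-- After the toss the vertex of `e` is assigned, so its coin is never read again. It can be
resampled freely, and both branches are expectations over a full set of fresh coins, as an induction
along the list requires. -/
theorem coinExp_foldl_cons [Fintype L] (G : HVM d L R E) (p : ℝ) (g : SimState L E → ℝ)
    (s : SimState L E) (e : E) (t : List E) (h : G.Tosses s e) :
    coinExp p (fun S => g ((e :: t).foldl (G.simStep S) s)) =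
      p * coinExp p (fun S => g (t.foldl (G.simStep S) (G.headState s e))) +
      (1 - p) * coinExp p (fun S => g (t.foldl (G.simStep S) (G.tailState s e))) := by
  rw [coinExp_split p _ (G.left e)]
  congr 2
  · congr 1
    funext S
    rw [List.foldl_cons, simStep_eq, if_pos h, if_pos (Finset.mem_insert_self _ _)]
    congr 1
    refine G.foldl_simStep_congr t _ fun l hl => ?_
    have hne : l ≠ G.left e := fun h' => hl (by simp [headState, h'])
    simp [hne]
  · congr 1
    funext S
    rw [List.foldl_cons, simStep_eq, if_pos h, if_neg (Finset.notMem_erase _ _)]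
    congr 1
    refine G.foldl_simStep_congr t _ fun l hl => ?_
    have hne : l ≠ G.left e := fun h' => hl (by simp [tailState, h'])
    simp [hne]

/-- A potential that does not decrease in expectation is a lower bound for the expected final
value. -/
theorem le_coinExp_foldl [Fintype L] (G : HVM d L R E) {p : ℝ} (hp0 : 0 ≤ p) (hp1 : p ≤ 1)
    (Inv : SimState L E → List E → Prop) (Φ : SimState L E → List E → ℝ) (g : SimState L E → ℝ)
    (hnil : ∀ s, Inv s [] → Φ s [] ≤ g s)
    (hskip : ∀ s e t, Inv s (e :: t) → Inv s t ∧ Φ s (e :: t) ≤ Φ s t)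
    (htoss : ∀ s e t, Inv s (e :: t) → G.Tosses s e →
      Inv (G.headState s e) t ∧ Inv (G.tailState s e) t ∧
        Φ s (e :: t) ≤ p * Φ (G.headState s e) t + (1 - p) * Φ (G.tailState s e) t)
    (ℓ : List E) : ∀ s, Inv s ℓ → Φ s ℓ ≤ coinExp p (fun S => g (ℓ.foldl (G.simStep S) s)) := by
  induction ℓ with
  | nil =>
    intro s hs
    simpa [coinExp_const] using hnil s hs
  | cons e t ih =>
    intro s hs
    by_cases h : G.Tosses s e
    · obtain ⟨h1, h2, h3⟩ := htoss s e t hs h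
      rw [coinExp_foldl_cons G p g s e t h]
      exact h3.trans (add_le_add (mul_le_mul_of_nonneg_left (ih _ h1) hp0)
        (mul_le_mul_of_nonneg_left (ih _ h2) (sub_nonneg.2 hp1)))
    · obtain ⟨h1, h2⟩ := hskip s e t hs
      have : ∀ S, G.simStep S s e = s := fun S => by rw [simStep_eq, if_neg h]
      simp only [List.foldl_cons, this]
      exact h2.trans (ih s h1)

/-- The vertices in `L` of all selected hyperedges are assigned. -/
def Valid (G : HVM d L R E) (s : SimState L E) : Prop :=
  (∀ e ∈ s.M₁, G.left e ∈ s.assigned) ∧ ∀ e ∈ s.M₂, G.left e ∈ s.assigned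

theorem Valid.headState {G : HVM d L R E} {s : SimState L E} (h : G.Valid s) (e : E) :
    G.Valid (G.headState s e) := by
  refine ⟨fun f hf => ?_, fun f hf => Finset.mem_insert_of_mem (h.2 f hf)⟩
  rcases Finset.mem_insert.1 hf with rfl | hf
  · exact Finset.mem_insert_self _ _
  · exact Finset.mem_insert_of_mem (h.1 f hf)

theorem Valid.tailState {G : HVM d L R E} {s : SimState L E} (h : G.Valid s) (e : E) :
    G.Valid (G.tailState s e) := by
  refine ⟨fun f hf => Finset.mem_insert_of_mem (h.1 f hf), fun f hf => ?_⟩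
  rcases Finset.mem_insert.1 hf with rfl | hf
  · exact Finset.mem_insert_self _ _
  · exact Finset.mem_insert_of_mem (h.2 f hf)

theorem Valid.notMem_M₁ {G : HVM d L R E} {s : SimState L E} (h : G.Valid s) {e : E}
    (he : G.Tosses s e) : e ∉ s.M₁ := fun h' => he.1 (h.1 e h')

theorem Valid.notMem_M₂ {G : HVM d L R E} {s : SimState L E} (h : G.Valid s) {e : E}
    (he : G.Tosses s e) : e ∉ s.M₂ := fun h' => he.1 (h.2 e h')

theorem totalWeight_insert (G : HVM d L R E) {M : Finset E} {e : E} (h : e ∉ M) :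
    G.totalWeight (insert e M) = G.weight e + G.totalWeight M :=
  Finset.sum_insert h

/-- Each hyperedge for which a coin is tossed goes to `M₁` with probability `p`, and to `M₂` with
probability `1 - p`. -/
theorem mul_coinExp_M₁_le [Fintype L] [Fintype E] [LinearOrder E] (G : HVM d L R E) {p : ℝ}
    (hp0 : 0 ≤ p) (hp1 : p ≤ 1) :
    (1 - p) * coinExp p (fun S => G.totalWeight (G.simulate S).M₁) ≤
      p * coinExp p (fun S => G.totalWeight (G.simulate S).M₂) := by
  -- The potential is a martingale: a toss of `e` lowers it by `(1 - p) * weight e` with probability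
  -- `p` and raises it by `p * weight e` with probability `1 - p`.
  have key := G.le_coinExp_foldl hp0 hp1 (fun s _ => G.Valid s)
    (fun s _ => p * G.totalWeight s.M₂ + -(1 - p) * G.totalWeight s.M₁)
    (fun s => p * G.totalWeight s.M₂ + -(1 - p) * G.totalWeight s.M₁)
    (fun _ _ => le_rfl) (fun _ _ _ h => ⟨h, le_rfl⟩)
    (fun s e t hs he => by
      refine ⟨hs.headState e, hs.tailState e, le_of_eq ?_⟩
      simp only [headState, tailState, G.totalWeight_insert (hs.notMem_M₁ he),
        G.totalWeight_insert (hs.notMem_M₂ he)]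
      ring)
    (G.sortEdges Finset.univ) ⟨∅, ∅, ∅⟩ ⟨by simp, by simp⟩
  rw [coinExp_add, coinExp_const_mul, coinExp_const_mul] at key
  simp only [totalWeight, Finset.sum_empty] at key
  simp only [totalWeight, simulate]
  linarith

/-! ### The weight of the isolated hyperedges -/

/-- The vertices in `R` of the members of `M`. -/
def cover (G : HVM d L R E) (M : Finset E) : Finset R := M.biUnion G.right

/-- The hyperedge `e` is disjoint from all other members of `M`. -/
def Isolated (G : HVM d L R E) (M : Finset E) (e : E) : Prop :=
  ∀ f ∈ M, f ≠ e → G.DisjointEdges e f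

/-- The vertices in `R` at which a member of `M₂` may still meet hyperedges to come. -/
def active (G : HVM d L R E) (s : SimState L E) : Finset R := G.cover s.M₂ \ G.cover s.M₁

/-- A lower bound for the expected final weight of the hyperedges in `M₂` that are isolated now
and remain so. -/
def isolatedPotential (G : HVM d L R E) (p : ℝ) (M₁ M₂ : Finset E) : ℝ :=
  ∑ e ∈ M₂, if G.Isolated M₂ e then G.weight e * p ^ #(G.right e \ G.cover M₁) else 0

theorem cover_insert (G : HVM d L R E) (M : Finset E) (e : E) :
    G.cover (insert e M) = G.right e ∪ G.cover M := Finset.biUnion_insert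

theorem disjoint_cover (G : HVM d L R E) {M : Finset E} {e : E} (h : G.DisjointFrom e M) :
    Disjoint (G.right e) (G.cover M) :=
  (Finset.disjoint_biUnion_right _ _ _).2 fun f hf => (h f hf).2

/-- Averaged with `card_active_tailState`, a toss changes the number of active vertices by `(1 - p)
* #(right e) - #(active ∩ right e)` in expectation. -/
theorem card_active_headState (G : HVM d L R E) (s : SimState L E) (e : E) :
    (#(G.active (G.headState s e)) : ℝ) = #(G.active s) - #(G.active s ∩ G.right e) := by
  have : G.active (G.headState s e) = G.active s \ G.right e := by
    ext v
    simp only [active, headState, cover_insert, Finset.mem_sdiff, Finset.mem_union]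
    tauto
  rw [this, ← Finset.card_sdiff_add_card_inter (G.active s) (G.right e)]
  push_cast
  ring

theorem card_active_tailState (G : HVM d L R E) (s : SimState L E) (e : E) (h : G.Tosses s e) :
    (#(G.active (G.tailState s e)) : ℝ) =
      #(G.active s) + #(G.right e) - #(G.active s ∩ G.right e) := by
  have hd := G.disjoint_cover h.2
  have : G.active (G.tailState s e) = G.active s ∪ G.right e := by
    ext v
    have : v ∈ G.right e → v ∉ G.cover s.M₁ := fun hv => Finset.disjoint_left.1 hd hv
    simp only [active, tailState, cover_insert, Finset.mem_sdiff, Finset.mem_union]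
    tauto
  have h2 := Finset.card_union_add_card_inter (G.active s) (G.right e)
  rw [this, eq_sub_iff_add_eq]
  exact_mod_cast h2

/-- The potential of an isolated `f` does not drop in expectation. If the tossed `e` meets `f`,
tails may destroy `f`, but heads covers a common vertex, which no later tossed hyperedge can
contain; the exponent falls by at least one, which compensates the factor `p`. A tossed `e` disjoint
from `M₂` contributes its own term on tails. -/
theorem isolatedPotential_le (G : HVM d L R E) {p : ℝ} (hp0 : 0 ≤ p) (hp1 : p ≤ 1)
    {s : SimState L E} (hs : G.Valid s) {e : E} (he : G.Tosses s e) :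
    G.isolatedPotential p s.M₁ s.M₂ +
        (if G.DisjointFrom e s.M₂ then (1 - p) * (G.weight e * p ^ d) else 0) ≤
      p * G.isolatedPotential p (insert e s.M₁) s.M₂ +
        (1 - p) * G.isolatedPotential p s.M₁ (insert e s.M₂) := by
  have hq : 0 ≤ 1 - p := sub_nonneg.2 hp1
  have hd := G.disjoint_cover he.2
  rw [isolatedPotential, isolatedPotential, isolatedPotential, Finset.sum_insert (hs.notMem_M₂ he), mul_add, Finset.mul_sum, Finset.mul_sum,
    add_comm, add_left_comm, ← Finset.sum_add_distrib]
  refine add_le_add ?_ (Finset.sum_le_sum fun f hf => ?_)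
  · by_cases h : G.DisjointFrom e s.M₂
    · have hi : G.Isolated (insert e s.M₂) e := fun f hf hne =>
        h f (Finset.mem_of_mem_insert_of_ne hf hne)
      rw [if_pos h, if_pos hi]
      refine mul_le_mul_of_nonneg_left (mul_le_mul_of_nonneg_left ?_ (G.weight_nonneg e)) hq
      exact pow_le_pow_of_le_one hp0 hp1
        ((Finset.card_le_card Finset.sdiff_subset).trans (G.card_right_le e))
    · rw [if_neg h]
      refine mul_nonneg hq ?_
      split_ifs
      · exact mul_nonneg (G.weight_nonneg e) (pow_nonneg hp0 _)
      · exact le_rfl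
  · have hw := G.weight_nonneg f
    have hnn : 0 ≤ (1 - p) * (if G.Isolated (insert e s.M₂) f then
        G.weight f * p ^ #(G.right f \ G.cover s.M₁) else 0) := by
      refine mul_nonneg hq ?_
      split_ifs
      · exact mul_nonneg hw (pow_nonneg hp0 _)
      · exact le_rfl
    by_cases hi : G.Isolated s.M₂ f
    swap
    · simpa only [if_neg hi, mul_zero, zero_add] using hnn
    rw [if_pos hi, if_pos hi]
    by_cases hfe : Disjoint (G.right f) (G.right e)
    · have hi' : G.Isolated (insert e s.M₂) f := by
        intro g hg hne
        rcases Finset.mem_insert.1 hg with rfl | hg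
        · exact ⟨fun h => he.1 (h ▸ hs.2 f hf), hfe⟩
        · exact hi g hg hne
      have hc : G.right f \ G.cover (insert e s.M₁) = G.right f \ G.cover s.M₁ := by
        ext v
        have : v ∈ G.right f → v ∉ G.right e := fun hv => Finset.disjoint_left.1 hfe hv
        simp only [cover_insert, Finset.mem_sdiff, Finset.mem_union]
        tauto
      rw [if_pos hi', hc]
      exact le_of_eq (by ring)
    · obtain ⟨v, hvf, hve⟩ := Finset.not_disjoint_iff.1 hfe
      -- The common vertex `v` was uncovered because `e` is disjoint from `M₁`, and heads covers it.
      have hlt : #(G.right f \ G.cover (insert e s.M₁)) + 1 ≤ #(G.right f \ G.cover s.M₁) := by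
        refine Finset.card_lt_card (Finset.ssubset_iff_of_subset ?_ |>.2 ⟨v, ?_, ?_⟩)
        · exact Finset.sdiff_subset_sdiff subset_rfl
            (by rw [cover_insert]; exact Finset.subset_union_right)
        · exact Finset.mem_sdiff.2 ⟨hvf, Finset.disjoint_left.1 hd hve⟩
        · simp [cover_insert, hve]
      have h1 := mul_le_mul_of_nonneg_left (pow_le_pow_of_le_one hp0 hp1 hlt) hw
      rw [pow_succ] at h1
      linarith

/-- The weight of the first member of a list of hyperedges. -/
def nextWeight (G : HVM d L R E) : List E → ℝ
  | [] => 0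
  | e :: _ => G.weight e

theorem nextWeight_le [LinearOrder E] (G : HVM d L R E) {e : E} {t : List E}
    (h : (e :: t).Pairwise G.Precedes) : G.nextWeight t ≤ G.weight e := by
  cases t with
  | nil => exact G.weight_nonneg e
  | cons f t =>
    rcases (List.pairwise_cons.1 h).1 f (by simp) with h | h
    · exact h.le
    · exact h.1.ge

/-- The potential reserves `2 * (1 - p) * nextWeight` for each active vertex, to pay for future
collisions there. Weights decrease along the list, so the reserve stays sufficient when a hyperedge
is passed over, and it vanishes at the end, where `nextWeight [] = 0`. -/
theorem totalWeight_M₂_le_isolated [Fintype L] [Fintype E] [LinearOrder E] (G : HVM d L R E)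
    {p : ℝ} (hp0 : 0 ≤ p) (hp1 : p ≤ 1) (hpd : 1 / 2 ≤ p ^ d) (hqd : (1 - p) * d ≤ 1 / 2) :
    coinExp p (fun S => G.totalWeight (G.simulate S).M₂) ≤
      4 * coinExp p (fun S => G.totalWeight (G.simulateM₃ S)) := by
  have hq : 0 ≤ 1 - p := sub_nonneg.2 hp1
  have key := G.le_coinExp_foldl hp0 hp1 (fun s ℓ => G.Valid s ∧ ℓ.Pairwise G.Precedes)
    (fun s ℓ => 4 * G.isolatedPotential p s.M₁ s.M₂ - G.totalWeight s.M₂ -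
      2 * (1 - p) * (G.nextWeight ℓ * #(G.active s)))
    (fun s => 4 * G.totalWeight (s.M₂.filter (G.Isolated s.M₂)) + (-1) * G.totalWeight s.M₂)
    (fun s _ => by
      have : G.isolatedPotential p s.M₁ s.M₂ ≤ G.totalWeight (s.M₂.filter (G.Isolated s.M₂)) := by
        rw [totalWeight, Finset.sum_filter]
        refine Finset.sum_le_sum fun e _ => ?_
        split_ifs
        · exact mul_le_of_le_one_right (G.weight_nonneg e) (pow_le_one₀ hp0 hp1)
        · exact le_rfl
      simp only [nextWeight]
      linarith)
    (fun s e t h => ⟨⟨h.1, (List.pairwise_cons.1 h.2).2⟩, by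
      have h1 := mul_le_mul_of_nonneg_left (mul_le_mul_of_nonneg_right (G.nextWeight_le h.2)
        (Nat.cast_nonneg (α := ℝ) #(G.active s))) (mul_nonneg zero_le_two hq)
      have h2 : G.nextWeight (e :: t) = G.weight e := rfl
      rw [h2]
      linarith⟩)
    (fun s e t h he => by
      refine ⟨⟨h.1.headState e, (List.pairwise_cons.1 h.2).2⟩,
        ⟨h.1.tailState e, (List.pairwise_cons.1 h.2).2⟩, ?_⟩
      have h0 := G.isolatedPotential_le hp0 hp1 h.1 he
      have hnw := G.nextWeight_le h.2
      have hw := G.weight_nonneg e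
      have h1 : ∀ s' : SimState L E, G.nextWeight t * #(G.active s') ≤
          G.weight e * #(G.active s') := fun s' =>
        mul_le_mul_of_nonneg_right hnw (Nat.cast_nonneg _)
      have h2 := mul_le_mul_of_nonneg_left (h1 (G.headState s e))
        (mul_nonneg (mul_nonneg zero_le_two hq) hp0)
      have h3 := mul_le_mul_of_nonneg_left (h1 (G.tailState s e))
        (mul_nonneg (mul_nonneg zero_le_two hq) hq)
      rw [card_active_headState] at h2
      rw [G.card_active_tailState s e he] at h3
      have h4 : G.nextWeight (e :: t) = G.weight e := rfl
      have h5 : G.totalWeight (G.tailState s e).M₂ = G.weight e + G.totalWeight s.M₂ :=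
        G.totalWeight_insert (h.1.notMem_M₂ he)
      have h6 : G.totalWeight (G.headState s e).M₂ = G.totalWeight s.M₂ := rfl
      have hr : (1 - p) * #(G.right e) ≤ 1 / 2 :=
        (mul_le_mul_of_nonneg_left (Nat.cast_le.2 (G.card_right_le e)) hq).trans hqd
      have h7 := mul_le_mul_of_nonneg_left hr (mul_nonneg (mul_nonneg zero_le_two hq) hw)
      have hqw : 0 ≤ (1 - p) * G.weight e := mul_nonneg hq hw
      -- The left side is the expected growth of `w(M₂)`. Without a collision, the gain `4 * p ^ d ≥
      -- 2`, in units of `(1 - p) * weight e`, pays one unit for this growth and one for the new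
      -- active vertices. With a collision, the expected number of active vertices drops by at least
      -- `1/2`, which releases one unit.
      have h8 : (1 - p) * G.weight e ≤
          4 * (if G.DisjointFrom e s.M₂ then (1 - p) * (G.weight e * p ^ d) else 0) -
          2 * (1 - p) * (G.weight e * (1 / 2 - #(G.active s ∩ G.right e))) := by
        by_cases hf : G.DisjointFrom e s.M₂
        · rw [if_pos hf]
          have := mul_le_mul_of_nonneg_left hpd hqw
          have := mul_nonneg hqw (Nat.cast_nonneg (α := ℝ) #(G.active s ∩ G.right e))
          linarith
        · rw [if_neg hf]
          have : 1 ≤ #(G.active s ∩ G.right e) := by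
            -- The collision is not in `L`, since the vertex of `e` is unassigned; the common vertex
            -- in `R` avoids `M₁`, so it is active.
            simp only [DisjointFrom, not_forall] at hf
            obtain ⟨f, hfM, hf⟩ := hf
            have hr : ¬ Disjoint (G.right e) (G.right f) := fun hr =>
              hf ⟨fun hl => he.1 (hl ▸ h.1.2 f hfM), hr⟩
            obtain ⟨v, hve, hvf⟩ := Finset.not_disjoint_iff.1 hr
            refine Finset.card_pos.2 ⟨v, Finset.mem_inter.2 ⟨Finset.mem_sdiff.2 ⟨?_, ?_⟩, hve⟩⟩
            · exact Finset.mem_biUnion.2 ⟨f, hfM, hvf⟩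
            · exact Finset.disjoint_left.1 (G.disjoint_cover he.2) hve
          have := mul_le_mul_of_nonneg_left (Nat.one_le_cast (α := ℝ).2 this) hqw
          linarith
      rw [h4, h5, h6, card_active_headState, G.card_active_tailState s e he]
      simp only [headState, tailState]
      linarith)
    (G.sortEdges Finset.univ) ⟨∅, ∅, ∅⟩
    ⟨⟨by simp, by simp⟩, Finset.pairwise_sort _ _⟩
  rw [coinExp_add, coinExp_const_mul, coinExp_const_mul] at key
  have hM : ∀ S : Finset L, G.simulateM₃ S =
      (G.simulate S).M₂.filter (G.Isolated (G.simulate S).M₂) := by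
    intro S
    ext e
    simp only [simulateM₃, Finset.mem_filter, DisjointFrom, Isolated, Finset.mem_erase]
    refine and_congr_right fun _ => forall_congr' fun f => ?_
    tauto
  have h0 : G.active (⟨∅, ∅, ∅⟩ : SimState L E) = ∅ := by simp [active, cover]
  simp only [h0, isolatedPotential, totalWeight, Finset.sum_empty, Finset.card_empty] at key
  simp only [hM, totalWeight, simulate]
  norm_num at key
  convert key
  ext
  exact Finset.mem_filter.trans Finset.mem_filter.symm

/-! ### Greedy -/

theorem sortEdges_filter [LinearOrder E] (G : HVM d L R E) (S : Finset E) (P : E → Prop)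
    [DecidablePred P] :
    G.sortEdges (S.filter P) = (G.sortEdges S).filter (fun e => decide (P e)) := by
  refine List.Perm.eq_of_pairwise' (r := G.Precedes) (Finset.pairwise_sort _ _)
    ((Finset.pairwise_sort _ _).filter _) ?_
  refine (List.perm_ext_iff_of_nodup (Finset.sort_nodup _ _)
    ((Finset.sort_nodup _ _).filter _)).2 fun e => ?_
  simp [Finset.mem_sort]

/-- The treatment of one hyperedge by Greedy. -/
def greedyStep (G : HVM d L R E) (M : Finset E) (e : E) : Finset E :=
  if G.DisjointFrom e M then insert e M else M

/-- The insertion in `greedy` decides equality by the linear order, that in `greedyStep`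
classically; hence extensionality instead of `rfl`. -/
theorem greedy_eq [Fintype E] [LinearOrder E] (G : HVM d L R E) (S : Finset L) :
    G.greedy S = (G.sortEdges {e | G.left e ∈ S}).foldl G.greedyStep ∅ := by
  unfold greedy
  congr 1
  funext M e
  refine if_congr Iff.rfl ?_ rfl
  ext
  simp only [Finset.mem_insert]

theorem eq_or_mem_of_mem_greedyStep {G : HVM d L R E} {M : Finset E} {e g : E}
    (h : g ∈ G.greedyStep M e) : g = e ∨ g ∈ M := by
  unfold greedyStep at h
  split_ifs at h
  · exact Finset.mem_insert.1 h
  · exact Or.inr h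

theorem self_mem_greedyStep {G : HVM d L R E} {M : Finset E} {e : E} (h : G.DisjointFrom e M) :
    e ∈ G.greedyStep M e := by
  rw [greedyStep, if_pos h]
  exact Finset.mem_insert_self _ _

theorem subset_foldl_greedyStep (G : HVM d L R E) (ℓ : List E) :
    ∀ M, M ⊆ ℓ.foldl G.greedyStep M := by
  induction ℓ with
  | nil => intro M; exact subset_rfl
  | cons e t ih =>
    intro M
    refine Finset.Subset.trans ?_ (ih _)
    unfold greedyStep
    split_ifs
    · exact Finset.subset_insert _ _
    · exact subset_rfl

theorem mem_of_mem_foldl_greedyStep (G : HVM d L R E) (ℓ : List E) :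
    ∀ M e, e ∈ ℓ.foldl G.greedyStep M → e ∈ M ∨ e ∈ ℓ := by
  induction ℓ with
  | nil => intro M e h; exact Or.inl h
  | cons f t ih =>
    intro M e h
    rcases ih _ _ h with h | h
    · rcases eq_or_mem_of_mem_greedyStep h with rfl | h
      · exact Or.inr (by simp)
      · exact Or.inl h
    · exact Or.inr (List.mem_cons_of_mem _ h)

theorem DisjointEdges.symm {G : HVM d L R E} {e f : E} (h : G.DisjointEdges e f) :
    G.DisjointEdges f e := ⟨h.1.symm, h.2.symm⟩

theorem IsMatching.insert {G : HVM d L R E} {M : Finset E} (h : G.IsMatching M) {e : E}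
    (he : G.DisjointFrom e M) : G.IsMatching (insert e M) := by
  intro f hf g hg hne
  rcases Finset.mem_insert.1 hf with rfl | hf'
  · exact he g (Finset.mem_of_mem_insert_of_ne hg hne.symm)
  · rcases Finset.mem_insert.1 hg with rfl | hg'
    · exact (he f hf').symm
    · exact h f hf' g hg' hne

theorem isMatching_foldl_greedyStep (G : HVM d L R E) (ℓ : List E) :
    ∀ M, G.IsMatching M → G.IsMatching (ℓ.foldl G.greedyStep M) := by
  induction ℓ with
  | nil => intro M h; exact h
  | cons e t ih =>
    intro M h
    refine ih _ ?_
    unfold greedyStep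
    split_ifs with he
    · exact h.insert he
    · exact h

theorem isMatching_greedy [Fintype E] [LinearOrder E] (G : HVM d L R E) (S : Finset L) :
    G.IsMatching (G.greedy S) := by
  rw [greedy_eq]
  exact G.isMatching_foldl_greedyStep _ _ G.isMatching_empty

theorem left_mem_of_mem_greedy [Fintype E] [LinearOrder E] (G : HVM d L R E) {S : Finset L}
    {e : E} (h : e ∈ G.greedy S) : G.left e ∈ S := by
  rw [greedy_eq] at h
  rcases G.mem_of_mem_foldl_greedyStep _ _ _ h with h | h
  · simp at h
  · simpa [sortEdges, Finset.mem_sort] using h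

/-- Every hyperedge is blocked by a selected one of at least its weight. -/
theorem exists_blocking [LinearOrder E] (G : HVM d L R E) (ℓ : List E) :
    ∀ M, (∀ g ∈ M, ∀ e ∈ ℓ, G.weight e ≤ G.weight g) → ℓ.Pairwise G.Precedes → ∀ e ∈ ℓ,
      ∃ g ∈ ℓ.foldl G.greedyStep M, G.weight e ≤ G.weight g ∧ ¬ G.DisjointEdges e g := by
  induction ℓ with
  | nil => intro M _ _ e he; simp at he
  | cons f t ih =>
    intro M hM hs e he
    have hs' := List.pairwise_cons.1 hs
    have hf : ∀ e ∈ t, G.weight e ≤ G.weight f := fun e he => by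
      rcases hs'.1 e he with h | h
      · exact h.le
      · exact h.1.ge
    rcases List.mem_cons.1 he with rfl | he
    · have hsub := G.subset_foldl_greedyStep t (G.greedyStep M e)
      by_cases h : G.DisjointFrom e M
      · refine ⟨e, hsub (self_mem_greedyStep h), le_rfl, fun h' => h'.1 rfl⟩
      · have hg := h
        simp only [DisjointFrom, not_forall] at hg
        obtain ⟨g, hgM, hg⟩ := hg
        refine ⟨g, hsub ?_, hM g hgM e (by simp), hg⟩
        rw [greedyStep, if_neg h]
        exact hgM
    · refine ih _ ?_ hs'.2 e he
      intro g hg e' he'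
      rcases eq_or_mem_of_mem_greedyStep hg with rfl | hg
      · exact hf e' he'
      · exact hM g hg e' (List.mem_cons_of_mem _ he')

/-- A hyperedge meets at most `d + 1` members of a matching. -/
theorem card_meeting_le (G : HVM d L R E) {M : Finset E} (hM : G.IsMatching M) (g : E) :
    #{e ∈ M | ¬ G.DisjointEdges e g} ≤ d + 1 := by
  -- `x e` names a vertex that `e` shares with `g`, where `none` stands for the one in `L`. Disjoint
  -- hyperedges share different vertices with `g`, so `x` is injective on the members of `M` meeting
  -- `g`.
  have hex : ∀ e, ∃ x : Option R, ¬ G.DisjointEdges e g →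
      x ∈ insert none ((G.right g).image some) ∧ (x = none → G.left e = G.left g) ∧
        ∀ v, x = some v → v ∈ G.right e := by
    intro e
    by_cases hl : G.left e = G.left g
    · exact ⟨none, fun _ => ⟨by simp, fun _ => hl, by simp⟩⟩
    · by_cases hr : Disjoint (G.right e) (G.right g)
      · exact ⟨none, fun h => absurd ⟨hl, hr⟩ h⟩
      · obtain ⟨v, hve, hvg⟩ := Finset.not_disjoint_iff.1 hr
        refine ⟨some v, fun _ => ⟨by simpa using hvg, by simp, ?_⟩⟩
        rintro w ⟨⟩
        exact hve
  choose x hx using hex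
  have hcard : #(insert none ((G.right g).image some)) ≤ d + 1 :=
    (Finset.card_insert_le _ _).trans
      (Nat.add_le_add_right (Finset.card_image_le.trans (G.card_right_le g)) 1)
  refine (Finset.card_le_card_of_injOn x ?_ ?_).trans hcard
  · intro e he
    exact (hx e (Finset.mem_filter.1 he).2).1
  · intro e he f hf hef
    obtain ⟨heM, he⟩ := Finset.mem_filter.1 he
    obtain ⟨hfM, hf⟩ := Finset.mem_filter.1 hf
    by_contra hne
    have hd := hM e heM f hfM hne
    cases hxe : x e with
    | none => exact hd.1 (((hx e he).2.1 hxe).trans ((hx f hf).2.1 (hef ▸ hxe)).symm)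
    | some v =>
      exact Finset.disjoint_left.1 hd.2 ((hx e he).2.2 v hxe) ((hx f hf).2.2 v (hef ▸ hxe))

/-- Each hyperedge of `M` at `S` is charged to a blocking Greedy hyperedge `b e` of at least its
weight, and each of these is charged at most `d + 1` times. -/
theorem totalWeight_le_greedy [Fintype E] [LinearOrder E] (G : HVM d L R E) (S : Finset L)
    {M : Finset E} (hM : G.IsMatching M) :
    G.totalWeight (M.filter fun e => G.left e ∈ S) ≤ (d + 1) * G.totalWeight (G.greedy S) := by
  have hb : ∀ e, ∃ g, G.left e ∈ S →
      g ∈ G.greedy S ∧ G.weight e ≤ G.weight g ∧ ¬ G.DisjointEdges e g := by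
    intro e
    by_cases he : G.left e ∈ S
    · obtain ⟨g, hg⟩ := G.exists_blocking (G.sortEdges {e | G.left e ∈ S}) ∅ (by simp)
        (Finset.pairwise_sort _ _) e (by simpa [sortEdges, Finset.mem_sort] using he)
      rw [← greedy_eq] at hg
      exact ⟨g, fun _ => hg⟩
    · exact ⟨e, fun h => absurd h he⟩
  choose b hb using hb
  rw [totalWeight, totalWeight, Finset.mul_sum,
    ← Finset.sum_fiberwise_of_maps_to (g := b) (t := G.greedy S)
      (fun e he => (hb e (Finset.mem_filter.1 he).2).1)]
  refine Finset.sum_le_sum fun g _ => ?_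
  have hcard : (#{e ∈ M.filter (fun e => G.left e ∈ S) | b e = g} : ℝ) ≤ d + 1 := by
    have h : #{e ∈ M.filter (fun e => G.left e ∈ S) | b e = g} ≤ d + 1 := by
      refine (Finset.card_le_card fun e he => ?_).trans (G.card_meeting_le hM g)
      obtain ⟨he', rfl⟩ := Finset.mem_filter.1 he
      obtain ⟨heM, heS⟩ := Finset.mem_filter.1 he'
      exact Finset.mem_filter.2 ⟨heM, (hb e heS).2.2⟩
    exact_mod_cast h
  refine (Finset.sum_le_card_nsmul _ _ (G.weight g) fun e he => ?_).trans ?_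
  · obtain ⟨he', rfl⟩ := Finset.mem_filter.1 he
    exact (hb e (Finset.mem_filter.1 he').2).2.1
  · rw [nsmul_eq_mul]
    exact mul_le_mul_of_nonneg_right hcard (G.weight_nonneg g)

/-- `M₁` in Simulate evolves as in Greedy on the hyperedges at the vertices showing heads. -/
theorem foldl_simStep_M₁ (G : HVM d L R E) (S : Finset L) (ℓ : List E) :
    ∀ s : SimState L E, (∀ l ∈ S, l ∈ s.assigned → ∃ e ∈ s.M₁, G.left e = l) → G.Valid s →
      (ℓ.foldl (G.simStep S) s).M₁ =
        (ℓ.filter fun e => decide (G.left e ∈ S)).foldl G.greedyStep s.M₁ := by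
  induction ℓ with
  | nil => intro s _ _; rfl
  | cons e t ih =>
    intro s hs hv
    rw [List.foldl_cons]
    by_cases hS : G.left e ∈ S
    · rw [List.filter_cons_of_pos (by simpa using hS), List.foldl_cons, simStep_eq]
      by_cases hd : G.DisjointFrom e s.M₁
      · have ht : G.Tosses s e := by
          refine ⟨fun ha => ?_, hd⟩
          obtain ⟨f, hf, hfe⟩ := hs _ hS ha
          exact (hd f hf).1 hfe.symm
        rw [if_pos ht, if_pos hS, ih _ ?_ (hv.headState e), greedyStep, if_pos hd]
        · rfl
        · intro l hl hla
          rcases Finset.mem_insert.1 hla with rfl | hla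
          · exact ⟨e, Finset.mem_insert_self _ _, rfl⟩
          · obtain ⟨f, hf, hfl⟩ := hs l hl hla
            exact ⟨f, Finset.mem_insert_of_mem hf, hfl⟩
      · rw [if_neg (fun h : G.Tosses s e => hd h.2), ih _ hs hv, greedyStep, if_neg hd]
    · rw [List.filter_cons_of_neg (by simpa using hS), simStep_eq]
      by_cases ht : G.Tosses s e
      · rw [if_pos ht, if_neg hS, ih _ ?_ (hv.tailState e)]
        · rfl
        · intro l hl hla
          rcases Finset.mem_insert.1 hla with rfl | hla
          · exact absurd hl hS
          · exact hs l hl hla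
      · rw [if_neg ht, ih _ hs hv]

theorem simulate_M₁ [Fintype E] [LinearOrder E] (G : HVM d L R E) (S : Finset L) :
    (G.simulate S).M₁ = G.greedy S := by
  rw [simulate, G.foldl_simStep_M₁ S _ _ (by simp) ⟨by simp, by simp⟩, greedy_eq,
    sortEdges_filter]

theorem mul_totalWeight_le_coinExp [Fintype L] [Fintype E] [LinearOrder E] (G : HVM d L R E)
    {p : ℝ} (hp0 : 0 ≤ p) (hp1 : p ≤ 1) {M : Finset E} (hM : G.IsMatching M) :
    p * G.totalWeight M ≤ (d + 1) * coinExp p (fun S => G.totalWeight (G.simulate S).M₁) := by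
  have h : coinExp p (fun S => G.totalWeight (M.filter fun e => G.left e ∈ S)) =
      p * G.totalWeight M := by
    simp only [totalWeight, Finset.sum_filter]
    rw [coinExp_sum, Finset.mul_sum]
    exact Finset.sum_congr rfl fun e _ => coinExp_mem p _ _
  rw [← h, ← coinExp_const_mul]
  refine coinExp_mono hp0 hp1 fun S => ?_
  rw [simulate_M₁]
  exact G.totalWeight_le_greedy S hM

theorem exists_totalWeight_eq_opt [Fintype E] (G : HVM d L R E) :
    ∃ M, G.IsMatching M ∧ G.totalWeight M = G.opt := by
  obtain ⟨M, hM, h⟩ := Finset.exists_mem_eq_sup'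
    (⟨∅, by simp [isMatching_empty]⟩ : (Finset.univ.filter G.IsMatching).Nonempty) G.totalWeight
  exact ⟨M, (Finset.mem_filter.1 hM).2, h.symm⟩

theorem opt_nonneg [Fintype E] (G : HVM d L R E) : 0 ≤ G.opt := by
  obtain ⟨M, -, h⟩ := G.exists_totalWeight_eq_opt
  rw [← h]
  exact Finset.sum_nonneg fun e _ => G.weight_nonneg e

/-! ### The competitive ratio of Simulate -/

theorem expectedM₃_eq [Fintype L] [Fintype E] [LinearOrder E] (G : HVM d L R E) :
    G.expectedM₃ = coinExp (sampleProb d) (fun S => G.totalWeight (G.simulateM₃ S)) := rfl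

/-- The bound on the power is Bernoulli's inequality, `(1 - 1/(2d)) ^ d ≥ 1 - d/(2d)`. -/
theorem sampleProb_bounds (hd : 1 ≤ d) : 0 < sampleProb d ∧ sampleProb d ≤ 1 ∧
    1 / 2 ≤ sampleProb d ^ d ∧ (1 - sampleProb d) * d = 1 / 2 := by
  have h1 : (1 : ℝ) ≤ d := by exact_mod_cast hd
  have h0 : (d : ℝ) ≠ 0 := by positivity
  have h2 : 1 / (2 * (d : ℝ)) ≤ 1 / 2 := by
    rw [div_le_div_iff₀ (by positivity) (by norm_num)]
    linarith
  have h3 : 0 ≤ 1 / (2 * (d : ℝ)) := by positivity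
  unfold sampleProb
  refine ⟨by linarith, by linarith, ?_, by field_simp; ring⟩
  have := one_add_mul_le_pow (a := -(1 / (2 * (d : ℝ)))) (by linarith) d
  have h4 : (1 : ℝ) + d * -(1 / (2 * (d : ℝ))) = 1 / 2 := by field_simp; ring
  rw [h4] at this
  exact this.trans_eq (by ring)

theorem opt_div_le_expectedM₃ [Fintype L] [Fintype E] [LinearOrder E] (G : HVM d L R E)
    (hd : 1 ≤ d) : G.opt / (12 * d * (d + 1)) ≤ G.expectedM₃ := by
  obtain ⟨hp, hp1, hpd, hqd⟩ := sampleProb_bounds hd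
  obtain ⟨M, hM, hopt⟩ := G.exists_totalWeight_eq_opt
  have h1 := G.mul_totalWeight_le_coinExp hp.le hp1 hM
  have h2 := G.mul_coinExp_M₁_le hp.le hp1
  have h3 := G.totalWeight_M₂_le_isolated hp.le hp1 hpd hqd.le
  have h0 := G.opt_nonneg
  rw [hopt] at h1
  rw [expectedM₃_eq]
  set p := sampleProb d
  set A := coinExp p (fun S => G.totalWeight (G.simulate S).M₁)
  set B := coinExp p (fun S => G.totalWeight (G.simulate S).M₂)
  set C := coinExp p (fun S => G.totalWeight (G.simulateM₃ S))
  have hd0 : (0 : ℝ) < d := by exact_mod_cast hd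
  have hq : 0 ≤ 1 - p := sub_nonneg.2 hp1
  have h4 : (1 - p) * G.opt ≤ (d + 1) * B := by
    refine le_of_mul_le_mul_left ?_ hp
    calc p * ((1 - p) * G.opt) = (1 - p) * (p * G.opt) := by ring
      _ ≤ (1 - p) * ((d + 1) * A) := mul_le_mul_of_nonneg_left h1 hq
      _ = (d + 1) * ((1 - p) * A) := by ring
      _ ≤ (d + 1) * (p * B) := mul_le_mul_of_nonneg_left h2 (by positivity)
      _ = p * ((d + 1) * B) := by ring
  have h5 : G.opt / 2 ≤ d * (d + 1) * (4 * C) :=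
    calc G.opt / 2 = d * ((1 - p) * G.opt) := by rw [← mul_assoc, mul_comm (d : ℝ), hqd]; ring
      _ ≤ d * ((d + 1) * B) := mul_le_mul_of_nonneg_left h4 hd0.le
      _ = d * (d + 1) * B := by ring
      _ ≤ d * (d + 1) * (4 * C) := mul_le_mul_of_nonneg_left h3 (by positivity)
  -- `h5` gives the constant `8`; since `OPT ≥ 0`, it can be relaxed to `12`.
  rw [div_le_iff₀ (by positivity)]
  linarith

/-! ### SampleAndPrice accepts all isolated hyperedges of Simulate -/

/-- At most one member of a matching contains `v`, so the sum defining the price has at most one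
term. If it has none, the price `0` is met by every hyperedge, weights being non-negative. -/
theorem meetsPrice_iff [LinearOrder E] (G : HVM d L R E) {M₁ : Finset E} (hM : G.IsMatching M₁)
    (e : E) (v : R) :
    G.MeetsPrice M₁ e v ↔ ∀ f ∈ M₁, v ∈ G.right f → G.Precedes e f := by
  by_cases h : ∃ f ∈ M₁, v ∈ G.right f
  · obtain ⟨f, hf, hv⟩ := h
    have hu : ∀ g ∈ M₁, v ∈ G.right g → g = f := fun g hg hvg => by
      by_contra hne
      exact Finset.disjoint_left.1 (hM g hg f hf hne).2 hvg hv
    have hp : G.price M₁ v = G.weight f := by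
      have : M₁.filter (fun g => v ∈ G.right g) = {f} := by
        ext g
        simp only [Finset.mem_filter, Finset.mem_singleton]
        exact ⟨fun h => hu g h.1 h.2, fun h => h ▸ ⟨hf, hv⟩⟩
      rw [price, this, Finset.sum_singleton]
    rw [MeetsPrice, hp]
    constructor
    · intro h g hg hvg
      obtain rfl := hu g hg hvg
      exact h.imp id fun h => ⟨h.1.symm, h.2 g hg hvg⟩
    · intro h
      refine (h f hf hv).imp id fun h => ⟨h.1.symm, fun g hg hvg => ?_⟩
      rw [hu g hg hvg]
      exact h.2
  · have h' : ∀ f ∈ M₁, v ∉ G.right f := fun f hf hv => h ⟨f, hf, hv⟩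
    have hp : G.price M₁ v = 0 := by
      rw [price, Finset.filter_false_of_mem h', Finset.sum_empty]
    rw [MeetsPrice, hp]
    refine ⟨fun _ f hf hv => absurd hv (h' f hf), fun _ => ?_⟩
    rcases (G.weight_nonneg e).lt_or_eq with h | h
    · exact Or.inl h
    · exact Or.inr ⟨h, fun f hf hv => absurd hv (h' f hf)⟩

theorem foldl_simStep_of_assigned (G : HVM d L R E) (S : Finset L) (l : L) (ℓ : List E) :
    ∀ s : SimState L E, l ∈ s.assigned → ∀ e, G.left e = l →
      (e ∈ (ℓ.foldl (G.simStep S) s).M₂ ↔ e ∈ s.M₂) := by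
  induction ℓ with
  | nil => intro s _ e _; rfl
  | cons f t ih =>
    intro s hs e he
    rw [List.foldl_cons, simStep_eq]
    by_cases ht : G.Tosses s f
    · have hne : e ≠ f := fun h => ht.1 (by rw [← h, he]; exact hs)
      rw [if_pos ht]
      split_ifs
      · exact ih _ (Finset.mem_insert_of_mem hs) e he
      · rw [ih _ (Finset.mem_insert_of_mem hs) e he]
        simp [tailState, hne]
    · rw [if_neg ht]
      exact ih s hs e he

theorem mem_M₂_foldl_simStep (G : HVM d L R E) (S : Finset L) (ℓ : List E) :
    ∀ s : SimState L E, ∀ e ∈ (ℓ.foldl (G.simStep S) s).M₂, e ∈ s.M₂ ∨ G.left e ∉ S := by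
  induction ℓ with
  | nil => intro s e he; exact Or.inl he
  | cons f t ih =>
    intro s e he
    rcases ih _ e he with h | h
    · rw [simStep_eq] at h
      split_ifs at h with h1 h2
      · exact Or.inl h
      · rcases Finset.mem_insert.1 h with rfl | h
        · exact Or.inr h2
        · exact Or.inl h
      · exact Or.inl h
    · exact Or.inr h

theorem left_notMem_of_mem_simulate_M₂ [Fintype E] [LinearOrder E] (G : HVM d L R E)
    {S : Finset L} {e : E} (he : e ∈ (G.simulate S).M₂) : G.left e ∉ S := by
  rcases G.mem_M₂_foldl_simStep S _ _ e he with h | h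
  · simp at h
  · exact h

theorem subset_foldl_simStep_M₁ (G : HVM d L R E) (S : Finset L) (ℓ : List E) :
    ∀ s : SimState L E, s.M₁ ⊆ (ℓ.foldl (G.simStep S) s).M₁ := by
  induction ℓ with
  | nil => intro s; exact subset_rfl
  | cons e t ih =>
    intro s
    refine Finset.Subset.trans ?_ (ih _)
    rw [simStep_eq]
    split_ifs
    · exact Finset.subset_insert _ _
    · exact subset_rfl
    · exact subset_rfl

theorem mem_M₁_foldl_simStep (G : HVM d L R E) (S : Finset L) (ℓ : List E) :
    ∀ s : SimState L E, ∀ f ∈ (ℓ.foldl (G.simStep S) s).M₁, f ∈ s.M₁ ∨ f ∈ ℓ := by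
  induction ℓ with
  | nil => intro s f hf; exact Or.inl hf
  | cons e t ih =>
    intro s f hf
    rcases ih _ f hf with h | h
    · rw [simStep_eq] at h
      split_ifs at h
      · rcases Finset.mem_insert.1 h with rfl | h
        · exact Or.inr (by simp)
        · exact Or.inl h
      · exact Or.inl h
      · exact Or.inl h
    · exact Or.inr (List.mem_cons_of_mem _ h)

/-- At a vertex showing tails, Simulate selects the first hyperedge that precedes all members of
the final `M₁` that it meets. -/
theorem mem_foldl_simStep_M₂_iff [LinearOrder E] (G : HVM d L R E) (S : Finset L) (N : Finset E)
    {l : L} (hl : l ∉ S) (ℓ : List E) :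
    ∀ s : SimState L E, (∀ f ∈ s.M₁, G.left f ∈ S ∧ ∀ e ∈ ℓ, G.Precedes f e) →
      (ℓ.foldl (G.simStep S) s).M₁ = N → ℓ.Pairwise G.Precedes → G.Valid s → l ∉ s.assigned →
      ∀ e, (e ∈ (ℓ.foldl (G.simStep S) s).M₂ ∧ G.left e = l) ↔
        (ℓ.filter fun e => decide (G.left e = l ∧
          ∀ v ∈ G.right e, ∀ f ∈ N, v ∈ G.right f → G.Precedes e f)).head? = some e := by
  induction ℓ with
  | nil =>
    intro s _ _ _ hv hla e
    simp only [List.foldl_nil, List.filter_nil, List.head?_nil, reduceCtorEq, iff_false]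
    rintro ⟨he, rfl⟩
    exact hla (hv.2 e he)
  | cons x t ih =>
    intro s hM hfin hs hv hla e
    have hs' := List.pairwise_cons.1 hs
    have hsN : s.M₁ ⊆ N := hfin ▸ G.subset_foldl_simStep_M₁ S (x :: t) s
    rw [List.foldl_cons] at hfin ⊢
    have hM' : ∀ f ∈ s.M₁, G.left f ∈ S ∧ ∀ e ∈ t, G.Precedes f e := fun f hf =>
      ⟨(hM f hf).1, fun e he => (hM f hf).2 e (List.mem_cons_of_mem _ he)⟩
    by_cases ht : G.Tosses s x
    · by_cases hxS : G.left x ∈ S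
      · have hstep : G.simStep S s x = G.headState s x := by
          rw [simStep_eq, if_pos ht, if_pos hxS]
        have hne : G.left x ≠ l := fun h => hl (h ▸ hxS)
        rw [hstep] at hfin ⊢
        rw [List.filter_cons_of_neg (by simp [hne])]
        refine ih _ ?_ hfin hs'.2 (hv.headState x) ?_ e
        · intro f hf
          rcases mem_headState_M₁.1 hf with rfl | hf
          · exact ⟨hxS, hs'.1⟩
          · exact hM' f hf
        · intro h
          rcases Finset.mem_insert.1 h with h | h
          · exact hne h.symm
          · exact hla h
      · have hstep : G.simStep S s x = G.tailState s x := by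
          rw [simStep_eq, if_pos ht, if_neg hxS]
        rw [hstep] at hfin ⊢
        by_cases hxl : G.left x = l
        · have hpos : G.left x = l ∧
              ∀ v ∈ G.right x, ∀ f ∈ N, v ∈ G.right f → G.Precedes x f := by
            refine ⟨hxl, fun v hvx f hf hvf => ?_⟩
            rw [← hfin] at hf
            rcases G.mem_M₁_foldl_simStep S t _ f hf with h | h
            · exact absurd hvf (Finset.disjoint_left.1 (ht.2 f h).2 hvx)
            · exact hs'.1 f h
          have hla' : l ∈ (G.tailState s x).assigned := hxl ▸ Finset.mem_insert_self _ _
          rw [List.filter_cons_of_pos (by simpa using hpos), List.head?_cons, Option.some_inj]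
          constructor
          · rintro ⟨he, hel⟩
            rw [G.foldl_simStep_of_assigned S l t _ hla' e hel] at he
            rcases mem_tailState_M₂.1 he with h | h
            · exact h.symm
            · exact absurd (hel ▸ hv.2 e h) hla
          · rintro rfl
            rw [G.foldl_simStep_of_assigned S l t _ hla' x hxl]
            exact ⟨mem_tailState_M₂.2 (Or.inl rfl), hxl⟩
        · rw [List.filter_cons_of_neg (by simp [hxl])]
          refine ih (G.tailState s x) hM' hfin hs'.2 (hv.tailState x) ?_ e
          intro h
          rcases Finset.mem_insert.1 h with h | h
          · exact hxl h.symm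
          · exact hla h
    · have hstep : G.simStep S s x = s := by rw [simStep_eq, if_neg ht]
      rw [hstep] at hfin ⊢
      -- As `l` is unassigned, `x` could only be rejected because of a current member `f` of `M₁`.
      -- It meets `x` in `R`, because `left f ∈ S`, and it precedes `x`; so `x` misses a price.
      have hneg : ¬ (G.left x = l ∧
          ∀ v ∈ G.right x, ∀ f ∈ N, v ∈ G.right f → G.Precedes x f) := by
        rintro ⟨hxl, hx⟩
        have hd : ¬ G.DisjointFrom x s.M₁ := fun hd => ht ⟨hxl ▸ hla, hd⟩
        simp only [DisjointFrom, not_forall] at hd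
        obtain ⟨f, hf, hd⟩ := hd
        have hlf : G.left x ≠ G.left f := fun h => hl (by rw [← hxl, h]; exact (hM f hf).1)
        have hr : ¬ Disjoint (G.right x) (G.right f) := fun hr => hd ⟨hlf, hr⟩
        obtain ⟨v, hvx, hvf⟩ := Finset.not_disjoint_iff.1 hr
        refine hlf (congrArg G.left ?_)
        exact antisymm_of G.Precedes (hx v hvx f (hsN hf) hvf) ((hM f hf).2 x (by simp))
      rw [List.filter_cons_of_neg (by simpa using hneg)]
      exact ih s hM' hfin hs'.2 hv hla e

/-- The members of `M₂` in Simulate are the candidates of SampleAndPrice. -/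
theorem mem_simulate_M₂_iff [Fintype E] [LinearOrder E] (G : HVM d L R E) {S : Finset L} {l : L}
    (hl : l ∉ S) (e : E) :
    (e ∈ (G.simulate S).M₂ ∧ G.left e = l) ↔ G.candidate (G.greedy S) l = some e := by
  rw [simulate, G.mem_foldl_simStep_M₂_iff S (G.greedy S) hl (G.sortEdges Finset.univ) ⟨∅, ∅, ∅⟩
    (by simp) (G.simulate_M₁ S) (Finset.pairwise_sort _ _) ⟨by simp, by simp⟩ (by simp) e,
    candidate, sortEdges_filter]
  simp only [G.meetsPrice_iff (G.isMatching_greedy S)]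
  congr!

/-- All accepted hyperedges lie in `M₂`, and a member of `M₃` is disjoint from every other member of
`M₂`, so nothing can block it when its vertex arrives. The condition `left g ∉ ℓ` ensures that it is
not itself among those accepted before. -/
theorem foldl_step_superset [Fintype E] [LinearOrder E] (G : HVM d L R E) (S : Finset L)
    (ℓ : List L) :
    ∀ M, (∀ g ∈ M, g ∈ (G.simulate S).M₂ ∧ G.left g ∉ ℓ) → ℓ.Nodup → (∀ l ∈ ℓ, l ∉ S) →
      ∀ e ∈ G.simulateM₃ S, (e ∈ M ∨ G.left e ∈ ℓ) →
        e ∈ ℓ.foldl (G.step (G.greedy S)) M := by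
  induction ℓ with
  | nil =>
    intro M _ _ _ e _ h
    exact h.resolve_right (by simp)
  | cons l t ih =>
    intro M hM hnd hS e he h
    obtain ⟨hlt, hnd'⟩ := List.nodup_cons.1 hnd
    have hiff := fun f => G.mem_simulate_M₂_iff (hS l (by simp)) f
    have hstep : (∀ g ∈ G.step (G.greedy S) M l, g ∈ M ∨
          (g ∈ (G.simulate S).M₂ ∧ G.left g = l)) ∧ M ⊆ G.step (G.greedy S) M l ∧
        (G.left e = l → e ∈ G.step (G.greedy S) M l) := by
      unfold step
      cases hc : G.candidate (G.greedy S) l with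
      | none =>
        refine ⟨fun g hg => Or.inl hg, subset_rfl, fun hel => ?_⟩
        have := (hiff e).1 ⟨(Finset.mem_filter.1 he).1, hel⟩
        simp [hc] at this
      | some c =>
        have hcM := (hiff c).2 hc
        refine ⟨fun g hg => ?_, ?_, fun hel => ?_⟩
        · dsimp only at hg
          split_ifs at hg
          · rw [Finset.mem_insert] at hg
            rcases hg with rfl | hg
            · exact Or.inr hcM
            · exact Or.inl hg
          · exact Or.inl hg
        · dsimp only
          split_ifs
          · exact Finset.subset_insert _ _
          · exact subset_rfl
        · have h1 := (hiff e).1 ⟨(Finset.mem_filter.1 he).1, hel⟩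
          obtain rfl : c = e := by simpa [hc] using h1
          have hd : G.DisjointFrom c M := fun g hg =>
            (Finset.mem_filter.1 he).2 g (Finset.mem_erase.2
              ⟨fun h => (hM g hg).2 (by rw [h, hel]; simp), (hM g hg).1⟩)
          dsimp only
          rw [if_pos hd]
          exact Finset.mem_insert_self _ _
    refine ih _ ?_ hnd' (fun l hl => hS l (List.mem_cons_of_mem _ hl)) e he ?_
    · intro g hg
      rcases hstep.1 g hg with h | h
      · exact ⟨(hM g h).1, fun h' => (hM g h).2 (List.mem_cons_of_mem _ h')⟩
      · exact ⟨h.1, h.2 ▸ hlt⟩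
    · rcases h with h | h
      · exact Or.inl (hstep.2.1 h)
      · rcases List.mem_cons.1 h with h | h
        · exact Or.inl (hstep.2.2 h)
        · exact Or.inr h

theorem totalWeight_simulateM₃_le [Fintype E] [LinearOrder E] (G : HVM d L R E) (k : ℕ)
    {σ : List L} (hnd : σ.Nodup) (hall : ∀ l, l ∈ σ) :
    G.totalWeight (G.simulateM₃ (σ.take k).toFinset) ≤
      G.totalWeight (sampleAndPrice k G σ) := by
  refine Finset.sum_le_sum_of_subset_of_nonneg (fun e he => ?_) fun e _ _ => G.weight_nonneg e
  have hnd' := hnd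
  rw [← List.take_append_drop k σ, List.nodup_append] at hnd'
  refine G.foldl_step_superset _ (σ.drop k) ∅ (by simp) hnd'.2.1 ?_ e he (Or.inr ?_)
  · intro l hl h
    exact hnd'.2.2 l (List.mem_toFinset.1 h) l hl rfl
  · have h1 := G.left_notMem_of_mem_simulate_M₂ (Finset.mem_filter.1 he).1
    have h2 := hall (G.left e)
    rw [← List.take_append_drop k σ, List.mem_append] at h2
    exact h2.resolve_left fun h => h1 (List.mem_toFinset.2 h)

/-! ### A binomial prefix of a random order is a random set -/

/-- The set of the first `k` arrivals. -/
def firstArrivals [Fintype L] (k : ℕ) (σ : Fin (Fintype.card L) ≃ L) : Finset L :=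
  ((List.ofFn σ).take k).toFinset

theorem card_firstArrivals [Fintype L] {k : ℕ} (hk : k ≤ Fintype.card L)
    (σ : Fin (Fintype.card L) ≃ L) : #(firstArrivals k σ) = k := by
  have hnd : (List.ofFn σ).Nodup := List.nodup_ofFn.2 σ.injective
  rw [firstArrivals, List.toFinset_card_of_nodup (hnd.sublist (List.take_sublist _ _)),
    List.length_take, List.length_ofFn, min_eq_left hk]

theorem firstArrivals_trans [Fintype L] (k : ℕ) (σ : Fin (Fintype.card L) ≃ L) (π : L ≃ L) :
    firstArrivals k (σ.trans π) = (firstArrivals k σ).map π.toEmbedding := by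
  have : List.ofFn (σ.trans π) = (List.ofFn σ).map π := by
    rw [List.map_ofFn]
    rfl
  ext l
  simp only [firstArrivals, this, ← List.map_take, List.mem_toFinset, List.mem_map,
    Finset.mem_map, Equiv.coe_toEmbedding]

/-- Composing arrival orders with a permutation of `L` that carries `S` to `T` injects one set of
orders into the other. -/
theorem card_firstArrivals_eq [Fintype L] (k : ℕ) {S T : Finset L} (h : #S = #T) :
    #{σ : Fin (Fintype.card L) ≃ L | firstArrivals k σ = S} =
      #{σ : Fin (Fintype.card L) ≃ L | firstArrivals k σ = T} := by
  have key : ∀ S T : Finset L, #S = #T →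
      #{σ : Fin (Fintype.card L) ≃ L | firstArrivals k σ = S} ≤
        #{σ : Fin (Fintype.card L) ≃ L | firstArrivals k σ = T} := by
    intro S T h
    obtain ⟨π, hπ⟩ : ∃ π : L ≃ L, S.map π.toEmbedding = T := by
      have e := Finset.equivOfCardEq h
      refine ⟨e.extendSubtype, Finset.eq_of_subset_of_card_le ?_ (by simp [h])⟩
      intro x hx
      obtain ⟨y, hy, rfl⟩ := Finset.mem_map.1 hx
      exact e.extendSubtype_mem y hy
    refine Finset.card_le_card_of_injOn (fun σ => σ.trans π) ?_ ?_
    · intro σ hσ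
      have hσ' := (Finset.mem_filter.1 hσ).2
      refine Finset.mem_filter.2 ⟨Finset.mem_univ _, ?_⟩
      rw [firstArrivals_trans, hσ', hπ]
    · intro σ _ τ _ hστ
      ext x
      have := congrArg (fun ρ : Fin (Fintype.card L) ≃ L => ρ x) hστ
      exact π.injective this
  exact le_antisymm (key S T h) (key T S h.symm)

theorem card_firstArrivals_mul_choose [Fintype L] (S : Finset L) :
    #{σ : Fin (Fintype.card L) ≃ L | firstArrivals #S σ = S} * (Fintype.card L).choose #S =
      (Fintype.card L).factorial := by
  have h1 : Fintype.card (Fin (Fintype.card L) ≃ L) = (Fintype.card L).factorial := by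
    rw [Fintype.card_equiv (Fintype.equivFin L).symm, Fintype.card_fin]
  refine Eq.trans ?_ h1
  rw [← Finset.card_univ (α := Fin (Fintype.card L) ≃ L),
    Finset.card_eq_sum_card_fiberwise (s := Finset.univ) (f := firstArrivals #S)
      (t := Finset.univ.powersetCard #S)]
  · rw [Finset.sum_congr rfl fun T hT =>
      card_firstArrivals_eq (T := S) #S (Finset.mem_powersetCard.1 hT).2, Finset.sum_const,
      Finset.card_powersetCard, Finset.card_univ, smul_eq_mul, mul_comm]
  · intro σ _
    exact Finset.mem_powersetCard.2 ⟨Finset.subset_univ _,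
      card_firstArrivals (Finset.card_le_univ _) σ⟩

/-- The first `k` arrivals form a uniformly random `k`-set, so the binomial coefficient in the law
of `k` cancels, and each set `S` gets its weight under independent coins. -/
theorem coinExp_eq_sum_arrivals [Fintype L] (p : ℝ) (f : Finset L → ℝ) :
    coinExp p f = ∑ k ∈ Finset.range (Fintype.card L + 1),
      ((Fintype.card L).choose k * p ^ k * (1 - p) ^ (Fintype.card L - k)) *
        ((∑ σ : Fin (Fintype.card L) ≃ L, f (firstArrivals k σ)) /
          (Fintype.card L).factorial) := by
  rw [coinExp, ← Finset.sum_fiberwise_of_maps_to (g := fun S : Finset L => #S)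
    (t := Finset.range (Fintype.card L + 1))
    (fun S _ => Finset.mem_range.2 (Nat.lt_succ_of_le (Finset.card_le_univ S)))]
  refine Finset.sum_congr rfl fun k hk => ?_
  have hk' : k ≤ Fintype.card L := Nat.lt_succ_iff.1 (Finset.mem_range.1 hk)
  have hfac : ((Fintype.card L).factorial : ℝ) ≠ 0 := by exact_mod_cast Nat.factorial_ne_zero _
  rw [← Finset.sum_fiberwise_of_maps_to (g := firstArrivals k)
    (t := Finset.univ.filter fun S : Finset L => #S = k)
    (fun σ _ => Finset.mem_filter.2 ⟨Finset.mem_univ _, card_firstArrivals hk' σ⟩),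
    Finset.sum_div, Finset.mul_sum]
  refine Finset.sum_congr rfl fun S hS => ?_
  obtain rfl := (Finset.mem_filter.1 hS).2
  have h1 : ∑ σ : Fin (Fintype.card L) ≃ L with firstArrivals #S σ = S,
      f (firstArrivals #S σ) =
        #{σ : Fin (Fintype.card L) ≃ L | firstArrivals #S σ = S} * f S := by
    rw [Finset.sum_congr rfl fun σ hσ => by rw [(Finset.mem_filter.1 hσ).2], Finset.sum_const,
      nsmul_eq_mul]
  have h2 : (#{σ : Fin (Fintype.card L) ≃ L | firstArrivals #S σ = S} : ℝ) *
      (Fintype.card L).choose #S = (Fintype.card L).factorial := by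
    exact_mod_cast card_firstArrivals_mul_choose S
  rw [h1, mul_div_assoc', eq_div_iff hfac, ← h2]
  ring

theorem expectedM₃_le [Fintype L] [Fintype E] [LinearOrder E] (G : HVM d L R E) (hd : 1 ≤ d) :
    G.expectedM₃ ≤ G.expectedSampleAndPrice := by
  obtain ⟨hp, hp1, -, -⟩ := sampleProb_bounds hd
  rw [expectedM₃_eq, coinExp_eq_sum_arrivals, expectedSampleAndPrice]
  refine Finset.sum_le_sum fun k _ => mul_le_mul_of_nonneg_left ?_
    (mul_nonneg (mul_nonneg (Nat.cast_nonneg _) (pow_nonneg hp.le _))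
      (pow_nonneg (sub_nonneg.2 hp1) _))
  refine div_le_div_of_nonneg_right (Finset.sum_le_sum fun σ _ => ?_) (Nat.cast_nonneg _)
  exact G.totalWeight_simulateM₃_le k (List.nodup_ofFn.2 σ.injective)
    fun l => List.mem_ofFn.2 ⟨σ.symm l, by simp⟩

theorem opt_div_le_expectedSampleAndPrice [Fintype L] [Fintype E] [LinearOrder E]
    (G : HVM d L R E) (hd : 1 ≤ d) :
    G.opt / (12 * d * (d + 1)) ≤ G.expectedSampleAndPrice :=
  (G.opt_div_le_expectedM₃ hd).trans (G.expectedM₃_le hd)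

theorem opt_le_mul_expectedSampleAndPrice [Fintype L] [Fintype E] [LinearOrder E]
    (G : HVM d L R E) (hd : 1 ≤ d) :
    G.opt ≤ 24 * (d : ℝ) ^ 2 * G.expectedSampleAndPrice := by
  have h := G.opt_div_le_expectedSampleAndPrice hd
  have h1 : (1 : ℝ) ≤ d := by exact_mod_cast hd
  have h0 : 0 ≤ G.expectedSampleAndPrice :=
    (div_nonneg G.opt_nonneg (by positivity)).trans h
  rw [div_le_iff₀ (by positivity)] at h
  -- This is `d + 1 ≤ 2 * d`.
  have h2 : 12 * (d : ℝ) * (d + 1) ≤ 24 * (d : ℝ) ^ 2 := by nlinarith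
  calc G.opt ≤ G.expectedSampleAndPrice * (12 * d * (d + 1)) := h
    _ ≤ G.expectedSampleAndPrice * (24 * (d : ℝ) ^ 2) := mul_le_mul_of_nonneg_left h2 h0
    _ = _ := mul_comm _ _

/-! ### SampleAndPrice is online -/

theorem sort_congr [LinearOrder E] {G G' : HVM d L R E} {S : Finset E}
    (h : ∀ e ∈ S, G.weight e = G'.weight e) : G.sortEdges S = G'.sortEdges S := by
  refine List.Perm.eq_of_pairwise' (r := G.Precedes) (Finset.pairwise_sort _ _) ?_
    ((List.perm_ext_iff_of_nodup (Finset.sort_nodup _ _) (Finset.sort_nodup _ _)).2 fun e => by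
      simp [Finset.mem_sort])
  refine List.Pairwise.imp_of_mem ?_ (Finset.pairwise_sort S G'.Precedes)
  intro a b ha hb hab
  rw [sortEdges, Finset.mem_sort] at ha hb
  rw [Precedes, h a ha, h b hb]
  exact hab

theorem foldl_greedyStep_congr {G G' : HVM d L R E} (T : Set E)
    (h : ∀ e ∈ T, G.left e = G'.left e ∧ G.right e = G'.right e) (ℓ : List E) :
    ∀ M : Finset E, (∀ e ∈ M, e ∈ T) → (∀ e ∈ ℓ, e ∈ T) →
      ℓ.foldl G.greedyStep M = ℓ.foldl G'.greedyStep M := by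
  induction ℓ with
  | nil => intro M _ _; rfl
  | cons e t ih =>
    intro M hM hℓ
    have heT := hℓ e (by simp)
    have hd : G.DisjointFrom e M ↔ G'.DisjointFrom e M :=
      forall₂_congr fun f hf => by
        rw [DisjointEdges, DisjointEdges, (h e heT).1, (h e heT).2, (h f (hM f hf)).1,
          (h f (hM f hf)).2]
    have hs : G.greedyStep M e = G'.greedyStep M e := by
      simp only [greedyStep, hd]
    rw [List.foldl_cons, List.foldl_cons, ← hs]
    refine ih _ (fun f hf => ?_) fun f hf => hℓ f (List.mem_cons_of_mem _ hf)
    rcases eq_or_mem_of_mem_greedyStep hf with rfl | hf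
    · exact heT
    · exact hM f hf

theorem SameRevealed.of_left_mem {G G' : HVM d L R E} {ℓ : List L} (h : SameRevealed G G' ℓ)
    {e : E} (he : G.left e ∈ ℓ) :
    G.left e = G'.left e ∧ G.right e = G'.right e ∧ G.weight e = G'.weight e := by
  have h' := h _ he e
  exact ⟨(h'.1.1 rfl).symm, h'.2 rfl⟩

theorem SameRevealed.greedy_eq [Fintype E] [LinearOrder E] {G G' : HVM d L R E} {ℓ : List L}
    (h : SameRevealed G G' ℓ) {S : Finset L} (hS : ∀ l ∈ S, l ∈ ℓ) :
    G.greedy S = G'.greedy S := by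
  have hset : (Finset.univ.filter fun e => G.left e ∈ S) =
      Finset.univ.filter fun e => G'.left e ∈ S := by
    refine Finset.filter_congr fun e _ => ⟨fun he => ?_, fun he => ?_⟩
    · rwa [← (h.of_left_mem (hS _ he)).1]
    · rwa [((h _ (hS _ he) e).1.2 rfl)]
  have hmem : ∀ e ∈ G.sortEdges {e | G.left e ∈ S}, G.left e ∈ S := fun e he => by
    simpa [sortEdges, Finset.mem_sort] using he
  rw [HVM.greedy_eq, HVM.greedy_eq, ← hset, ← sort_congr fun e he =>
    (h.of_left_mem (hS _ (Finset.mem_filter.1 he).2)).2.2]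
  exact foldl_greedyStep_congr {e | G.left e ∈ ℓ}
    (fun e he => ⟨(h.of_left_mem he).1, (h.of_left_mem he).2.1⟩) _ _ (by simp)
    fun e he => hS _ (hmem e he)

/-- Only hyperedges at `l` and members of `M₁` enter the choice, and all of these have been
revealed. -/
theorem SameRevealed.candidate_eq [Fintype E] [LinearOrder E] {G G' : HVM d L R E}
    {ℓ : List L} (h : SameRevealed G G' ℓ) {M₁ : Finset E} (hM : ∀ e ∈ M₁, G.left e ∈ ℓ) {l : L}
    (hl : l ∈ ℓ) : G.candidate M₁ l = G'.candidate M₁ l := by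
  have hprice : ∀ v, G.price M₁ v = G'.price M₁ v := fun v => by
    rw [price, price, Finset.filter_congr fun e he => by
      rw [(h.of_left_mem (hM e he)).2.1]]
    exact Finset.sum_congr rfl fun e he =>
      (h.of_left_mem (hM e (Finset.mem_filter.1 he).1)).2.2
  have hset : (Finset.univ.filter fun e => G.left e = l ∧
        ∀ v ∈ G.right e, G.MeetsPrice M₁ e v) =
      Finset.univ.filter fun e => G'.left e = l ∧ ∀ v ∈ G'.right e, G'.MeetsPrice M₁ e v := by
    refine Finset.filter_congr fun e _ => ?_
    rw [← (h l hl e).1]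
    refine and_congr_right fun he => ?_
    obtain ⟨hr, hw⟩ := (h l hl e).2 he
    rw [hr]
    refine forall₂_congr fun v _ => ?_
    rw [MeetsPrice, MeetsPrice, hprice, hw]
    refine or_congr Iff.rfl (and_congr_right fun _ => forall₂_congr fun f hf => ?_)
    rw [(h.of_left_mem (hM f hf)).2.1]
  rw [candidate, candidate, ← hset, sort_congr fun e he =>
    ((h l hl e).2 (Finset.mem_filter.1 he).2.1).2]

theorem left_eq_of_candidate [Fintype E] [LinearOrder E] (G : HVM d L R E) {M₁ : Finset E} {l : L}
    {e : E} (h : G.candidate M₁ l = some e) : G.left e = l := by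
  have h' := List.mem_of_head? h
  rw [sortEdges, Finset.mem_sort] at h'
  exact (Finset.mem_filter.1 h').2.1

/-- An arriving vertex leaves the matching as it is or adds a disjoint hyperedge at it. -/
theorem step_cases [Fintype E] [LinearOrder E] (G : HVM d L R E) (M₁ M : Finset E) (l : L) :
    G.step M₁ M l = M ∨
      ∃ e, G.left e = l ∧ G.DisjointFrom e M ∧ G.step M₁ M l = insert e M := by
  unfold step
  cases hc : G.candidate M₁ l with
  | none => exact Or.inl rfl
  | some e =>
    by_cases hd : G.DisjointFrom e M
    · exact Or.inr ⟨e, G.left_eq_of_candidate hc, hd, if_pos hd⟩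
    · exact Or.inl (if_neg hd)

theorem SameRevealed.foldl_step_eq [Fintype E] [LinearOrder E] {G G' : HVM d L R E}
    {ℓ : List L} (h : SameRevealed G G' ℓ) {M₁ : Finset E} (hM₁ : ∀ e ∈ M₁, G.left e ∈ ℓ)
    (t : List L) :
    ∀ M : Finset E, (∀ e ∈ M, G.left e ∈ ℓ) → (∀ l ∈ t, l ∈ ℓ) →
      t.foldl (G.step M₁) M = t.foldl (G'.step M₁) M := by
  induction t with
  | nil => intro M _ _; rfl
  | cons l t ih =>
    intro M hM ht
    have hl := ht l (by simp)
    have hs : G.step M₁ M l = G'.step M₁ M l := by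
      unfold step
      rw [← h.candidate_eq hM₁ hl]
      cases hc : G.candidate M₁ l with
      | none => rfl
      | some e =>
        have hel : G.left e ∈ ℓ := (G.left_eq_of_candidate hc).symm ▸ hl
        have hd : G.DisjointFrom e M ↔ G'.DisjointFrom e M :=
          forall₂_congr fun f hf => by
            rw [DisjointEdges, DisjointEdges, (h.of_left_mem hel).1, (h.of_left_mem hel).2.1,
              (h.of_left_mem (hM f hf)).1, (h.of_left_mem (hM f hf)).2.1]
        simp only [hd]
    rw [List.foldl_cons, List.foldl_cons, ← hs]
    refine ih _ (fun f hf => ?_) fun l hl => ht l (List.mem_cons_of_mem _ hl)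
    rcases G.step_cases M₁ M l with h' | ⟨e, he, -, h'⟩
    · exact hM f (h' ▸ hf)
    · rw [h', Finset.mem_insert] at hf
      rcases hf with rfl | hf
      · rwa [he]
      · exact hM f hf

theorem isOnline_sampleAndPrice [Fintype E] [LinearOrder E] (k : ℕ) :
    IsOnline (sampleAndPrice k : HVM d L R E → List L → Finset E) := by
  refine ⟨fun G => by simp [sampleAndPrice], fun G ℓ l _ => ?_, fun G G' ℓ h => ?_⟩
  · unfold sampleAndPrice
    -- If `k` vertices have arrived, the sample and hence the prices are fixed, and `l` adds one
    -- `step`; otherwise `l` is itself sampled and nothing is accepted.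
    rcases le_or_gt k ℓ.length with hk | hk
    · rw [List.take_append_of_le_length hk, List.drop_append_of_le_length hk, List.foldl_append]
      rcases G.step_cases (G.greedy (ℓ.take k).toFinset)
        ((ℓ.drop k).foldl (G.step (G.greedy (ℓ.take k).toFinset)) ∅) l with h | ⟨e, he, hd, h⟩
      · exact Or.inl h
      · refine Or.inr ⟨e, he, hd, h.trans ?_⟩
        ext
        simp only [Finset.mem_insert]
    · left
      rw [List.drop_eq_nil_of_le (by simpa using hk), List.drop_eq_nil_of_le hk.le]
      rfl
  · have hS : ∀ l ∈ (ℓ.take k).toFinset, l ∈ ℓ := fun l hl =>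
      List.mem_of_mem_take (List.mem_toFinset.1 hl)
    unfold sampleAndPrice
    rw [← h.greedy_eq hS]
    exact h.foldl_step_eq (fun e he => hS _ (G.left_mem_of_mem_greedy he)) _ _ (by simp)
      fun l hl => List.mem_of_mem_drop hl

end HVM

/-! ### Edge arrivals in hypergraphs and graphs as a special case -/

namespace HEM

variable {d : ℕ} {V E : Type*}

/-- The added vertices are private, so they create no new intersections between distinct hyperedges.
-/
theorem isMatching_toHVM_iff (H : HEM d V E) (M : Finset E) :
    H.toHVM.IsMatching M ↔ H.IsMatching M :=
  forall₂_congr fun _ _ => forall₂_congr fun _ _ =>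
    ⟨fun h hne => (h hne).2, fun h hne => ⟨hne, h hne⟩⟩

theorem opt_toHVM [Fintype E] (H : HEM d V E) : H.toHVM.opt = H.opt := by
  unfold HVM.opt opt
  congr 1
  ext M
  simp only [Finset.mem_filter, isMatching_toHVM_iff]

theorem expectedSampleAndPrice_toHVM [Fintype E] [LinearOrder E] (H : HEM d V E) :
    H.toHVM.expectedSampleAndPrice = H.expectedSampleAndPrice := by
  unfold HVM.expectedSampleAndPrice expectedSampleAndPrice
  refine Finset.sum_congr rfl fun k _ => ?_
  congr 2
  refine Finset.sum_congr ?_ fun σ _ => rfl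
  ext
  simp only [Finset.mem_univ]

theorem totalWeight_le_opt [Fintype E] (H : HEM d V E) {M : Finset E} (hM : H.IsMatching M) :
    H.totalWeight M ≤ H.opt :=
  Finset.le_sup' H.totalWeight (Finset.mem_filter.2 ⟨Finset.mem_univ _, hM⟩)

theorem isOnline_sampleAndPrice [Fintype E] [LinearOrder E] (k : ℕ) :
    IsOnline (sampleAndPrice k : HEM d V E → List E → Finset E) := by
  obtain ⟨h1, h2, h3⟩ := HVM.isOnline_sampleAndPrice (d := d) (L := E) (R := V) (E := E) k
  refine ⟨fun H => h1 H.toHVM, fun H ℓ e hnd => ?_, fun H H' ℓ h => h3 _ _ ℓ ?_⟩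
  · rcases h2 H.toHVM ℓ e hnd with h | ⟨f, hf, hd, h⟩
    · exact Or.inl h
    · obtain rfl : f = e := hf
      refine Or.inr ⟨fun g hg => (hd g hg).2, h.trans ?_⟩
      ext
      simp only [Finset.mem_insert]
      rfl
  · intro l hl e
    refine ⟨Iff.rfl, fun he => ?_⟩
    obtain rfl : e = l := he
    exact h e hl

theorem opt_div_le_expectedSampleAndPrice [Fintype E] [LinearOrder E] (H : HEM d V E)
    (hd : 1 ≤ d) : H.opt / (12 * d * (d + 1)) ≤ H.expectedSampleAndPrice := by
  rw [← opt_toHVM, ← expectedSampleAndPrice_toHVM]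
  exact H.toHVM.opt_div_le_expectedSampleAndPrice hd

theorem opt_le_mul_expectedSampleAndPrice [Fintype E] [LinearOrder E] (H : HEM d V E)
    (hd : 1 ≤ d) : H.opt ≤ 24 * (d : ℝ) ^ 2 * H.expectedSampleAndPrice := by
  rw [← opt_toHVM, ← expectedSampleAndPrice_toHVM]
  exact H.toHVM.opt_le_mul_expectedSampleAndPrice hd

/-- Two edges of `M` with a common vertex `v` both join `v` to its unique neighbour in `M`, so they
coincide. -/
theorem isMatching_ofGraph {V : Type*} {Γ : SimpleGraph V} [Fintype Γ.edgeSet] {w : Γ.edgeSet → ℝ}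
    {hw : ∀ e, 0 ≤ w e} {M : Γ.Subgraph} (hM : M.IsMatching) :
    (ofGraph Γ w hw).IsMatching
      (Finset.univ.filter fun e : Γ.edgeSet => (e : Sym2 V) ∈ M.edgeSet) := by
  intro e he f hf hne
  have he' := (Finset.mem_filter.1 he).2
  have hf' := (Finset.mem_filter.1 hf).2
  by_contra hd
  obtain ⟨v, hve, hvf⟩ := Finset.not_disjoint_iff.1 hd
  have hve' : v ∈ (e : Sym2 V) := Sym2.mem_toFinset.1 hve
  have hvf' : v ∈ (f : Sym2 V) := Sym2.mem_toFinset.1 hvf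
  obtain ⟨x, hx⟩ := Sym2.mem_iff_exists.1 hve'
  obtain ⟨y, hy⟩ := Sym2.mem_iff_exists.1 hvf'
  rw [hx, SimpleGraph.Subgraph.mem_edgeSet] at he'
  rw [hy, SimpleGraph.Subgraph.mem_edgeSet] at hf'
  obtain ⟨z, -, hz⟩ := hM (M.edge_vert he')
  exact hne (Subtype.ext (by rw [hx, hy, hz x he', hz y hf']))

theorem subgraphWeight_le {V : Type*} {Γ : SimpleGraph V} [Fintype Γ.edgeSet]
    [LinearOrder Γ.edgeSet] {w : Γ.edgeSet → ℝ} (hw : ∀ e, 0 ≤ w e) {M : Γ.Subgraph}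
    (hM : M.IsMatching) :
    subgraphWeight w M ≤ 72 * (ofGraph Γ w hw).expectedSampleAndPrice := by
  have h1 := (ofGraph Γ w hw).opt_div_le_expectedSampleAndPrice one_le_two
  have h2 : subgraphWeight w M ≤ (ofGraph Γ w hw).opt :=
    totalWeight_le_opt _ (isMatching_ofGraph hM)
  -- For `d = 2` the constant `12 * d * (d + 1)` is `72`.
  rw [div_le_iff₀ (by norm_num)] at h1
  norm_num at h1
  linarith

end HEM

end


theorem mainTheorem2 :
    -- Vertex-at-a-time: SampleAndPrice is an online algorithm, the set of hyperedges isolated in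
    -- Simulate has expected weight at least OPT / (12 d (d + 1)), and so has its output.
    (∀ (d : ℕ), 1 ≤ d → ∀ (L R E : Type*) [Fintype L] [Fintype E] [LinearOrder E],
      (∀ k : ℕ, HVM.IsOnline (HVM.sampleAndPrice k : HVM d L R E → List L → Finset E)) ∧
      ∀ G : HVM d L R E,
        G.opt / (12 * d * (d + 1)) ≤ G.expectedM₃ ∧
        G.opt / (12 * d * (d + 1)) ≤ G.expectedSampleAndPrice ∧
        G.opt ≤ 24 * (d : ℝ) ^ 2 * G.expectedSampleAndPrice) ∧
    -- Edge-at-a-time matching in hypergraphs.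
    (∀ (d : ℕ), 1 ≤ d → ∀ (V E : Type*) [Fintype E] [LinearOrder E],
      (∀ k : ℕ, HEM.IsOnline (HEM.sampleAndPrice k : HEM d V E → List E → Finset E)) ∧
      ∀ H : HEM d V E,
        H.opt / (12 * d * (d + 1)) ≤ H.expectedSampleAndPrice ∧
        H.opt ≤ 24 * (d : ℝ) ^ 2 * H.expectedSampleAndPrice) ∧
    -- Edge-at-a-time matching in general graphs.
    (∀ (V : Type*) (Γ : SimpleGraph V) [Fintype Γ.edgeSet] [LinearOrder Γ.edgeSet]
      (w : Γ.edgeSet → ℝ) (hw : ∀ e, 0 ≤ w e) (M : Γ.Subgraph), M.IsMatching →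
        subgraphWeight w M ≤ 72 * (HEM.ofGraph Γ w hw).expectedSampleAndPrice) := by
  refine ⟨fun d hd L R E _ _ _ => ⟨fun k => HVM.isOnline_sampleAndPrice k, fun G =>
      ⟨G.opt_div_le_expectedM₃ hd, G.opt_div_le_expectedSampleAndPrice hd,
        G.opt_le_mul_expectedSampleAndPrice hd⟩⟩,
    fun d hd V E _ _ => ⟨fun k => HEM.isOnline_sampleAndPrice k, fun H =>
      ⟨H.opt_div_le_expectedSampleAndPrice hd, H.opt_le_mul_expectedSampleAndPrice hd⟩⟩,
    fun V Γ _ _ w hw M hM => HEM.subgraphWeight_le hw hM⟩
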